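/- Let $m,s\ge 2$ be integers. For integers $a\le b+1$, call the $ms$-pyramid with base $[a,b]$ the set of integers $msi+j$ with $i\ge 0$, $0\le j\le ms-1$ and $a+i\le j\le b-i$. Let $\mathcal L_m(s)$ be the union of the $ms$-pyramids with bases $[(k-1)s+1,ks-1]$ for $1\le k\le m-1$ and of the $ms$-pyramid with base $[(m-1)s+1,ms-2]$. For a finite nonempty set $S\subseteq\mathcal L_m(s)$ put $$f(S)=\sum_{x\in S}x-\frac{|S|(|S|-1)}2,\qquad t=t(S)=\min\{i\ge 1: S\subseteq[0,ims-1]\},$$ and for $i\ge1$ put $\mathcal B_i=S\cap[(i-1)s,is-1]$, $a_i=|\mathcal B_i|$ and $n_i=\max\{x \bmod s: x\in\mathcal B_i\}$ (with $n_i=0$ if $\mathcal B_i=\emptyset$). Call $S$ a generalized-$\beta$-set if: 1. if $1\le i<\lceil (s-1)/2\rceil m$ and $a_i=0$, then $a_{i+1}=0$; 2. if $1\le i<tm$ and $m\nmid i$, then $a_i\ge a_{i+1}$; 3. if $1\le i\le (t-1)m$ and $a_{i+m}>0$, then $a_{i+m}\le a_i-2$; 4. if $1\le i<tm$, $m\nmid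 i$ and $a_{i+1}>0$, then $n_i\ge n_{i+1}$; 5. if $1\le i<tm$, $m\nmid i$ and $a_i=a_{i+1}>0$, then $n_i=n_{i+1}$; 6. if $t\ge2$, then $a_{(t-1)m}\ge a_{(t-1)m+1}$. Theorem. Call a generalized-$\beta$-set $S\subseteq\mathcal L_m(s)$ a maximizer if $f(S)\ge f(S')$ for every generalized-$\beta$-set $S'\subseteq\mathcal L_m(s)$. (i) If $s$ is odd, then every maximizer satisfies $t=\frac{s-1}2$ and one of (1) $a_{(t-1)m+1}=\dots=a_{tm}=1$; (2) $a_{(t-1)m+1}=\dots=a_{tm-1}=2$ and $a_{tm}=1$. (ii) If $s\ge4$ is even, then every maximizer satisfies $t=\frac s2$, $a_{tm}=0$ and one of (1) $a_{(t-1)m}=a_{(t-1)m+1}=\dots=a_{tm-1}=1$; (2) $a_{(t-1)m}=2$ and $a_{(t-1)m+1}=\dots=a_{tm-1}=1$. In (i) and in (ii), each of the two cases holds for exactly one maximizer; so there are exactly two maximizers. (iii) If $s=2$, then there is exactly one maximizer, and it satisfies $t=1$, $a_1=\dots=a_{m-1}=1$ and $a_m=0$. -/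

import Mathlib

namespace GenBeta

/-- The `N`-pyramid with base `[a, b]`: the positions `(i, j)` (row `i`, column `j`) of the
`N`-abacus with `a + i ≤ j ≤ b - i`. The position `(i, j)` stands for the integer `N * i + j`. -/
def pyramid (N a b : ℕ) : Set ℕ :=
  {x | ∃ i j : ℕ, j < N ∧ a + i ≤ j ∧ j + i ≤ b ∧ x = N * i + j}

/-- The set `𝓛_m(s)`: the union of the `ms`-pyramids `P_k` with base `[(k-1)s+1, ks-1]`
for `1 ≤ k ≤ m-1` and of the `ms`-pyramid `P_m` with base `[(m-1)s+1, ms-2]`. -/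
def bigL (m s : ℕ) : Set ℕ :=
  {x | ∃ k : ℕ, 1 ≤ k ∧ k ≤ m - 1 ∧ x ∈ pyramid (m * s) ((k - 1) * s + 1) (k * s - 1)} ∪
    pyramid (m * s) ((m - 1) * s + 1) (m * s - 2)

/-- The size-counting function `f(S) = ∑_{x ∈ S} x - |S|(|S|-1)/2`. -/
def sizeCount (S : Finset ℕ) : ℚ :=
  ∑ x ∈ S, (x : ℚ) - (S.card : ℚ) * ((S.card : ℚ) - 1) / 2

/-- `t(S) = min {i ≥ 1 : S ⊆ [0, ims - 1]}`. -/
noncomputable def numRows (m s : ℕ) (S : Finset ℕ) : ℕ :=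
  sInf {i : ℕ | 1 ≤ i ∧ ∀ x ∈ S, x < i * (m * s)}

/-- `𝓑_i(S) = S ∩ [(i-1)s, is-1]`, for `i ≥ 1`. -/
def block (s : ℕ) (S : Finset ℕ) (i : ℕ) : Finset ℕ :=
  S.filter fun x => (i - 1) * s ≤ x ∧ x < i * s

/-- `a_i(S) = |𝓑_i(S)|`. -/
def a (s : ℕ) (S : Finset ℕ) (i : ℕ) : ℕ :=
  (block s S i).card

/-- `n_i(S)`, the largest residue mod `s` of an element of `𝓑_i(S)`; it is `0` if
`𝓑_i(S)` is empty. -/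
def n (s : ℕ) (S : Finset ℕ) (i : ℕ) : ℕ :=
  (block s S i).sup fun x => x % s

/-- Generalized-β-sets. The number `⌈(s-1)/2⌉` is written out as a natural-number ceiling, and
the sixth condition, which concerns `a_{(t-1)m}`, is void when `t = 1`. -/
structure IsGenBetaSet (m s : ℕ) (S : Finset ℕ) : Prop where
  nonempty : S.Nonempty
  subset : (S : Set ℕ) ⊆ bigL m s
  cond1 : ∀ i, 1 ≤ i → i < ⌈((s : ℚ) - 1) / 2⌉₊ * m → a s S i = 0 → a s S (i + 1) = 0
  cond2 : ∀ i, 1 ≤ i → i < numRows m s S * m → ¬ m ∣ i → a s S (i + 1) ≤ a s S i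
  cond3 : ∀ i, 1 ≤ i → i ≤ (numRows m s S - 1) * m → 0 < a s S (i + m) →
    a s S (i + m) + 2 ≤ a s S i
  cond4 : ∀ i, 1 ≤ i → i < numRows m s S * m → ¬ m ∣ i → 0 < a s S (i + 1) →
    n s S (i + 1) ≤ n s S i
  cond5 : ∀ i, 1 ≤ i → i < numRows m s S * m → ¬ m ∣ i → a s S i = a s S (i + 1) →
    0 < a s S (i + 1) → n s S i = n s S (i + 1)
  cond6 : 2 ≤ numRows m s S →
    a s S ((numRows m s S - 1) * m + 1) ≤ a s S ((numRows m s S - 1) * m)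

/-- `S` is a generalized-β-set that maximizes `f` among all generalized-β-sets in `𝓛_m(s)`. -/
def IsMaximizer (m s : ℕ) (S : Finset ℕ) : Prop :=
  IsGenBetaSet m s S ∧ ∀ S' : Finset ℕ, IsGenBetaSet m s S' → sizeCount S' ≤ sizeCount S

/-- `t = (s-1)/2` and `a_{(t-1)m+1} = ⋯ = a_{tm} = 1`. -/
def OddCase1 (m s : ℕ) (S : Finset ℕ) : Prop :=
  numRows m s S = (s - 1) / 2 ∧
    ∀ i, (numRows m s S - 1) * m + 1 ≤ i → i ≤ numRows m s S * m → a s S i = 1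

/-- `t = (s-1)/2`, `a_{(t-1)m+1} = ⋯ = a_{tm-1} = 2` and `a_{tm} = 1`. -/
def OddCase2 (m s : ℕ) (S : Finset ℕ) : Prop :=
  numRows m s S = (s - 1) / 2 ∧
    (∀ i, (numRows m s S - 1) * m + 1 ≤ i → i ≤ numRows m s S * m - 1 → a s S i = 2) ∧
    a s S (numRows m s S * m) = 1

/-- `t = s/2`, `a_{(t-1)m+1} = ⋯ = a_{tm-1} = 1` and `a_{tm} = 0`. -/
def EvenLastRow (m s : ℕ) (S : Finset ℕ) : Prop :=
  numRows m s S = s / 2 ∧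
    (∀ i, (numRows m s S - 1) * m + 1 ≤ i → i ≤ numRows m s S * m - 1 → a s S i = 1) ∧
    a s S (numRows m s S * m) = 0

/-- `t = s/2`, `a_{(t-1)m} = ⋯ = a_{tm-1} = 1` and `a_{tm} = 0`. -/
def EvenCase1 (m s : ℕ) (S : Finset ℕ) : Prop :=
  EvenLastRow m s S ∧ a s S ((numRows m s S - 1) * m) = 1

/-- `t = s/2`, `a_{(t-1)m} = 2`, `a_{(t-1)m+1} = ⋯ = a_{tm-1} = 1` and `a_{tm} = 0`. -/
def EvenCase2 (m s : ℕ) (S : Finset ℕ) : Prop :=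
  EvenLastRow m s S ∧ a s S ((numRows m s S - 1) * m) = 2

end GenBeta

/-!
Arrange the block sizes of a generalized-`β`-set in an array with `m` blocks per row, counting rows
and columns from `0`. For prescribed sizes, `f` is largest when every block is pushed to the top of
the range of residues that `𝓛_m(s)` leaves it, and the defect measures how far the set is from that.
The remaining bound is quadratic in the deviations of the array from one whose columns decrease by
exactly `2`, and its cross terms are moments of monotone sequences, along columns and along rows.

For all but one shape of the array the signs of the moments already give a strict inequality. In the
remaining shape the deviations reduce to a monotone array of `N` entries, and the moments are
bounded below by multiples of `x * (N - x)`, where `x` is the sum of the entries. Equality forces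
all entries to be `0` or all of them to be `1`, which is where the two maximizers come from.
-/

namespace GenBeta

open Finset

section Moments

variable {n G w : ℕ} {z : ℕ → ℤ} {e : ℕ → ℕ → ℤ}

/-- Twice the signed distance from the midpoint of `0, …, n - 1` to `i`. -/
def centered (n i : ℕ) : ℤ := 2 * i - (n - 1)

/-- Twice the first moment of `z 0, …, z (n - 1)` about the midpoint of the index range. -/
def moment (n : ℕ) (z : ℕ → ℤ) : ℤ := ∑ i ∈ range n, centered n i * z i

theorem moment_succ (n : ℕ) (z : ℕ → ℤ) :
    moment (n + 1) z = moment n z + ∑ i ∈ range n, (z n - z i) := by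
  simp only [moment, centered, sum_range_succ, sum_sub_distrib, sum_const, card_range, nsmul_eq_mul,
    sub_mul, Nat.cast_succ, add_sub_cancel_right, ← mul_sum]
  ring

theorem moment_congr {z' : ℕ → ℤ} (h : ∀ i < n, z i = z' i) : moment n z = moment n z' :=
  sum_congr rfl fun i hi => by rw [h i (mem_range.1 hi)]

theorem moment_const (n : ℕ) (c : ℤ) : moment n (fun _ => c) = 0 := by
  induction n with
  | zero => simp [moment]
  | succ n ih => simp [moment_succ, ih]

theorem moment_sub (n : ℕ) (z z' : ℕ → ℤ) :
    moment n (fun i => z i - z' i) = moment n z - moment n z' := by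
  simp only [moment, mul_sub, sum_sub_distrib]

theorem moment_mul (n : ℕ) (c : ℤ) (z : ℕ → ℤ) :
    moment n (fun i => c * z i) = c * moment n z := by
  rw [moment, moment, mul_sum]
  exact sum_congr rfl fun i _ => by ring

theorem sum_centered (n : ℕ) : ∑ i ∈ range n, centered n i = 0 := by
  simpa [moment] using moment_const n 1

theorem three_mul_moment_centered (n : ℕ) : 3 * moment n (centered n) = n * (n ^ 2 - 1) := by
  have hid (n : ℕ) : 6 * moment n (fun i => (i : ℤ)) = n * (n ^ 2 - 1) := by
    induction n with
    | zero => simp [moment]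
    | succ n ih =>
      have hsum := sum_centered n
      simp only [centered, sum_sub_distrib, ← mul_sum, sum_const, card_range, nsmul_eq_mul] at hsum
      rw [moment_succ, mul_add, ih, sum_sub_distrib, sum_const, card_range, nsmul_eq_mul]
      push_cast
      linear_combination -3 * hsum
  have hcentered : centered n = fun i : ℕ => 2 * (i : ℤ) - (n - 1) := rfl
  rw [hcentered, moment_sub, moment_const, moment_mul]
  linear_combination hid n

theorem moment_nonneg (hz : MonotoneOn z (Set.Iio n)) : 0 ≤ moment n z := by
  induction n with
  | zero => simp [moment]
  | succ n ih =>
    rw [moment_succ]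
    refine add_nonneg (ih (hz.mono (Set.Iio_subset_Iio n.le_succ))) (sum_nonneg fun i hi => ?_)
    have hi := mem_range.1 hi
    exact sub_nonneg.2 (hz (hi.trans n.lt_succ_self) n.lt_succ_self hi.le)

theorem moment_nonpos (hz : AntitoneOn z (Set.Iio n)) : moment n z ≤ 0 := by
  simpa [moment] using moment_nonneg hz.neg

theorem moment_add_range (a b : ℕ) (z : ℕ → ℤ) :
    moment (a + b) z = moment a z + moment b (fun i => z (a + i)) +
      a * ∑ i ∈ range b, z (a + i) - b * ∑ i ∈ range a, z i := by
  have bottom : ∑ i ∈ range a, centered (a + b) i * z i =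
      moment a z - b * ∑ i ∈ range a, z i := by
    rw [moment, mul_sum, ← sum_sub_distrib]
    exact sum_congr rfl fun i _ => by simp only [centered]; push_cast; ring
  have top : ∑ i ∈ range b, centered (a + b) (a + i) * z (a + i) =
      moment b (fun i => z (a + i)) + a * ∑ i ∈ range b, z (a + i) := by
    rw [moment, mul_sum, ← sum_add_distrib]
    exact sum_congr rfl fun i _ => by simp only [centered]; push_cast; ring
  rw [moment, sum_range_add, bottom, top]
  ring

theorem exists_sign_change (hz : MonotoneOn z (Set.Iio n)) :
    ∃ a j, n = a + j ∧ (∀ i < a, z i ≤ 0) ∧ ∀ i < j, 0 < z (a + i) := by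
  induction n with
  | zero => exact ⟨0, 0, rfl, by simp, by simp⟩
  | succ n ih =>
    obtain ⟨a, j, rfl, hneg, hpos⟩ := ih (hz.mono (Set.Iio_subset_Iio n.le_succ))
    rcases le_or_gt (z (a + j)) 0 with hlast | hlast
    · refine ⟨a + j + 1, 0, rfl, fun i hi => ?_, by simp⟩
      exact (hz hi (Nat.lt_succ_self (a + j)) (by omega)).trans hlast
    · refine ⟨a, j + 1, rfl, hneg, fun i hi => ?_⟩
      rcases (Nat.lt_succ_iff.1 hi).lt_or_eq with hi | rfl
      exacts [hpos i hi, hlast]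

theorem mul_sub_le_moment (hz : MonotoneOn z (Set.Iio n)) :
    (∑ i ∈ range n, z i) * (n - ∑ i ∈ range n, z i) ≤ moment n z := by
  obtain ⟨a, j, rfl, hneg, hpos⟩ := exists_sign_change hz
  -- With `q` and `S` the sums of the nonpositive and of the positive terms, the moment is at least
  -- `a * S - j * q`, and `S ≥ j` by integrality.
  have hbottom : 0 ≤ moment a z :=
    moment_nonneg (hz.mono (Set.Iio_subset_Iio (Nat.le_add_right a j)))
  have htop : 0 ≤ moment j fun i => z (a + i) := moment_nonneg fun x hx y hy hxy =>
    hz (Nat.add_lt_add_left hx a) (Nat.add_lt_add_left hy a) (Nat.add_le_add_left hxy a)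
  have hq : ∑ i ∈ range a, z i ≤ 0 := sum_nonpos fun i hi => hneg i (mem_range.1 hi)
  have hS : (j : ℤ) ≤ ∑ i ∈ range j, z (a + i) := by
    simpa using card_nsmul_le_sum (range j) (fun i => z (a + i)) 1
      fun i hi => hpos i (mem_range.1 hi)
  rw [moment_add_range, sum_range_add]
  generalize ∑ i ∈ range a, z i = q at *
  generalize ∑ i ∈ range j, z (a + i) = S at *
  push_cast
  have ha : (0 : ℤ) ≤ a := a.cast_nonneg
  have hj : (0 : ℤ) ≤ j := j.cast_nonneg
  rcases le_total (j : ℤ) (q + S) with h | h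
  · nlinarith [mul_nonneg (hj.trans h) (sub_nonneg.2 h), mul_nonneg ha (neg_nonneg.2 hq),
      mul_nonneg hj (neg_nonneg.2 hq)]
  · rcases le_total (q + S) 0 with h0 | h0
    · nlinarith [mul_nonneg ha (hj.trans hS), mul_nonneg hj (neg_nonneg.2 hq),
        mul_nonneg (neg_nonneg.2 h0) (by linarith : (0 : ℤ) ≤ a + j - (q + S))]
    · nlinarith [mul_nonneg ha (neg_nonneg.2 hq), mul_nonneg h0 (sub_nonneg.2 h),
        mul_nonneg hj (by linarith : (0 : ℤ) ≤ S - j)]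

theorem mul_sum_sq_sub_sq_sum_le {W : ℤ} (hz : MonotoneOn z (Set.Iio n))
    (h0 : ∀ i < n, 0 ≤ z i) (hW : ∀ i < n, z i ≤ W) :
    n * ∑ i ∈ range n, z i ^ 2 - (∑ i ∈ range n, z i) ^ 2 ≤ W * moment n z := by
  induction n with
  | zero => simp [moment]
  | succ n ih =>
    have hlast := ih (hz.mono (Set.Iio_subset_Iio n.le_succ)) (fun i hi => h0 i (by omega))
      fun i hi => hW i (by omega)
    have hstep : ∑ i ∈ range n, (z n - z i) ^ 2 ≤ W * ∑ i ∈ range n, (z n - z i) := by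
      rw [mul_sum]
      refine sum_le_sum fun i hi => ?_
      have hi := mem_range.1 hi
      have hle : z i ≤ z n := hz (hi.trans n.lt_succ_self) n.lt_succ_self hi.le
      nlinarith [h0 i (by omega), hW n n.lt_succ_self]
    have hexpand : ∑ i ∈ range n, (z n - z i) ^ 2 =
        n * z n ^ 2 - 2 * z n * ∑ i ∈ range n, z i + ∑ i ∈ range n, z i ^ 2 := by
      simp only [sub_sq, sum_add_distrib, sum_sub_distrib, sum_const, card_range, nsmul_eq_mul,
        mul_sum]
    rw [moment_succ, sum_range_succ, sum_range_succ]
    push_cast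
    linarith

theorem zero_le_sq_sub_self (x : ℤ) : 0 ≤ x ^ 2 - x := by
  rcases le_or_gt x 0 with hx | hx
  · linarith [sq_nonneg x]
  · nlinarith

theorem mul_sub_le_sum_add_mul_moment {K : ℤ} (hK : 1 ≤ K) (hz : MonotoneOn z (Set.Iio n)) :
    (∑ i ∈ range n, z i) * (n - ∑ i ∈ range n, z i) ≤
      ∑ i ∈ range n, (z i ^ 2 - z i) + K * moment n z := by
  have hsq : 0 ≤ ∑ i ∈ range n, (z i ^ 2 - z i) := sum_nonneg fun i _ => zero_le_sq_sub_self (z i)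
  linarith [mul_sub_le_moment hz, mul_nonneg (sub_nonneg.2 hK) (moment_nonneg hz)]

theorem eq_zero_or_eq_one_of_sum_mul_eq_zero {ι : Type*} {A : Finset ι} {d : ι → ℤ}
    (h0 : ∀ i ∈ A, 0 ≤ d i) (h1 : ∀ i ∈ A, d i ≤ 1)
    (h : (∑ i ∈ A, d i) * (#A - ∑ i ∈ A, d i) = 0) :
    (∀ i ∈ A, d i = 0) ∨ ∀ i ∈ A, d i = 1 := by
  rcases mul_eq_zero.1 h with h | h
  · exact .inl ((sum_eq_zero_iff_of_nonneg h0).1 h)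
  · have hsum : ∑ i ∈ A, d i = ∑ i ∈ A, 1 := by simpa using (sub_eq_zero.1 h).symm
    exact .inr ((sum_eq_sum_iff_of_le h1).1 hsum)

theorem eq_zero_or_eq_one_of_mul_sub_eq {K : ℤ} (hK : 1 < K) (hz : MonotoneOn z (Set.Iio n))
    (heq : (∑ i ∈ range n, z i) * (n - ∑ i ∈ range n, z i) =
      ∑ i ∈ range n, (z i ^ 2 - z i) + K * moment n z) :
    (∀ i < n, z i = 0) ∨ ∀ i < n, z i = 1 := by
  have hle := mul_sub_le_moment hz
  have hsq : 0 ≤ ∑ i ∈ range n, (z i ^ 2 - z i) := sum_nonneg fun i _ => zero_le_sq_sub_self (z i)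
  have hmoment : moment n z = 0 := by nlinarith [moment_nonneg hz]
  rw [hmoment] at heq hle
  have hzero : ∑ i ∈ range n, (z i ^ 2 - z i) = 0 := by linarith
  have hbounds (i) (hi : i ∈ range n) : 0 ≤ z i ∧ z i ≤ 1 := by
    have := (sum_eq_zero_iff_of_nonneg fun i _ => zero_le_sq_sub_self (z i)).1 hzero i hi
    constructor <;> nlinarith
  simpa only [mem_range] using eq_zero_or_eq_one_of_sum_mul_eq_zero
    (fun i hi => (hbounds i hi).1) (fun i hi => (hbounds i hi).2)
    (by rw [card_range, heq, hzero, mul_zero, add_zero])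

/-- The sum of the entries of an array in rows `< G` and columns `< w`. -/
def total (G w : ℕ) (e : ℕ → ℕ → ℤ) : ℤ := ∑ r ∈ range G, ∑ k ∈ range w, e r k

/-- The moment in the row direction of an array with `G` rows and `w` columns. -/
def rowMoment (G w : ℕ) (e : ℕ → ℕ → ℤ) : ℤ := moment G fun r => ∑ k ∈ range w, e r k

/-- The moment in the column direction of an array with `G` rows and `w` columns. -/
def colMoment (G w : ℕ) (e : ℕ → ℕ → ℤ) : ℤ := ∑ r ∈ range G, moment w (e r)

theorem total_congr {e' : ℕ → ℕ → ℤ} (h : ∀ r < G, ∀ k < w, e r k = e' r k) :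
    total G w e = total G w e' :=
  sum_congr rfl fun r hr => sum_congr rfl fun k hk => h r (mem_range.1 hr) k (mem_range.1 hk)

theorem rowMoment_congr {e' : ℕ → ℕ → ℤ} (h : ∀ r < G, ∀ k < w, e r k = e' r k) :
    rowMoment G w e = rowMoment G w e' :=
  moment_congr fun r hr => sum_congr rfl fun k hk => h r hr k (mem_range.1 hk)

theorem colMoment_congr {e' : ℕ → ℕ → ℤ} (h : ∀ r < G, ∀ k < w, e r k = e' r k) :
    colMoment G w e = colMoment G w e' :=
  sum_congr rfl fun r hr => moment_congr fun k hk => h r (mem_range.1 hr) k hk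

theorem rowMoment_nonneg (hcol : ∀ k < w, MonotoneOn (e · k) (Set.Iio G)) :
    0 ≤ rowMoment G w e :=
  moment_nonneg fun _ hr _ hr' hrr => sum_le_sum fun k hk => hcol k (mem_range.1 hk) hr hr' hrr

theorem colMoment_nonneg (hrow : ∀ r < G, MonotoneOn (e r) (Set.Iio w)) : 0 ≤ colMoment G w e :=
  sum_nonneg fun r hr => moment_nonneg (hrow r (mem_range.1 hr))

theorem rowMoment_nonpos (hcol : ∀ k < w, AntitoneOn (e · k) (Set.Iio G)) :
    rowMoment G w e ≤ 0 :=
  moment_nonpos fun _ hr _ hr' hrr => sum_le_sum fun k hk => hcol k (mem_range.1 hk) hr hr' hrr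

theorem colMoment_nonpos (hrow : ∀ r < G, AntitoneOn (e r) (Set.Iio w)) : colMoment G w e ≤ 0 :=
  sum_nonpos fun r hr => moment_nonpos (hrow r (mem_range.1 hr))

/-- A discrete isoperimetric inequality for monotone `0`-`1` arrays: the number of zeros times the
number of ones is controlled by the two moments. -/
theorem total_mul_sub_total_le (h0 : ∀ r < G, ∀ k < w, 0 ≤ e r k)
    (h1 : ∀ r < G, ∀ k < w, e r k ≤ 1) (hrow : ∀ r < G, MonotoneOn (e r) (Set.Iio w))
    (hcol : ∀ k < w, MonotoneOn (e · k) (Set.Iio G)) :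
    total G w e * (G * w - total G w e) ≤ w * rowMoment G w e + G * colMoment G w e := by
  have hrows : G * ∑ r ∈ range G, (∑ k ∈ range w, e r k) ^ 2 - total G w e ^ 2 ≤
      w * rowMoment G w e := by
    refine mul_sum_sq_sub_sq_sum_le
      (fun _ hr _ hr' hrr => sum_le_sum fun k hk => hcol k (mem_range.1 hk) hr hr' hrr)
      (fun r hr => sum_nonneg fun k hk => h0 r hr k (mem_range.1 hk)) fun r hr => ?_
    simpa using sum_le_card_nsmul (range w) (e r) 1 fun k hk => h1 r hr k (mem_range.1 hk)
  have hcols : w * total G w e - ∑ r ∈ range G, (∑ k ∈ range w, e r k) ^ 2 ≤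
      colMoment G w e := by
    rw [total, colMoment, mul_sum, ← sum_sub_distrib]
    refine sum_le_sum fun r hr => ?_
    linarith [mul_sub_le_moment (hrow r (mem_range.1 hr))]
  nlinarith [mul_le_mul_of_nonneg_left hcols (Nat.cast_nonneg (α := ℤ) G)]

end Moments

section Gain

variable {m : ℕ}

theorem total_sub (G w : ℕ) (e e' : ℕ → ℕ → ℤ) :
    total G w (fun r k => e r k - e' r k) = total G w e - total G w e' := by
  simp only [total, sum_sub_distrib]

theorem rowMoment_sub (G w : ℕ) (e e' : ℕ → ℕ → ℤ) :
    rowMoment G w (fun r k => e r k - e' r k) = rowMoment G w e - rowMoment G w e' := by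
  simp only [rowMoment, sum_sub_distrib, moment_sub]

theorem colMoment_sub (G w : ℕ) (e e' : ℕ → ℕ → ℤ) :
    colMoment G w (fun r k => e r k - e' r k) = colMoment G w e - colMoment G w e' := by
  simp only [colMoment, moment_sub, sum_sub_distrib]

theorem total_rows (G w : ℕ) (f : ℕ → ℤ) :
    total G w (fun r _ => f r) = w * ∑ r ∈ range G, f r := by
  simp only [total, sum_const, card_range, nsmul_eq_mul, mul_sum]

theorem rowMoment_rows (G w : ℕ) (f : ℕ → ℤ) :
    rowMoment G w (fun r _ => f r) = w * moment G f := by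
  simp only [rowMoment, sum_const, card_range, nsmul_eq_mul, moment_mul]

theorem colMoment_rows (G w : ℕ) (f : ℕ → ℤ) : colMoment G w (fun r _ => f r) = 0 := by
  simp only [colMoment, moment_const, sum_const_zero]

theorem total_const (G w : ℕ) (c : ℤ) : total G w (fun _ _ => c) = G * w * c := by
  simp only [total, sum_const, card_range, nsmul_eq_mul, mul_assoc]

theorem rowMoment_const (G w : ℕ) (c : ℤ) : rowMoment G w (fun _ _ => c) = 0 := by
  rw [rowMoment_rows, moment_const, mul_zero]

theorem total_add_centered (G w : ℕ) (e : ℕ → ℕ → ℤ) :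
    total G w (fun r k => e r k + centered G r) = total G w e := by
  have hcentered := total_rows G w (centered G)
  rw [sum_centered, mul_zero] at hcentered
  simpa only [total, sum_add_distrib, add_eq_left] using hcentered

theorem total_succ_right (G w : ℕ) (e : ℕ → ℕ → ℤ) :
    total G (w + 1) e = total G w e + ∑ r ∈ range G, e r w := by
  simp only [total, sum_range_succ, sum_add_distrib]

theorem rowMoment_succ_right (G w : ℕ) (e : ℕ → ℕ → ℤ) :
    rowMoment G (w + 1) e = rowMoment G w e + moment G (e · w) := by
  simp only [rowMoment, moment, sum_range_succ, mul_add, sum_add_distrib]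

theorem colMoment_succ_right (G w : ℕ) (e : ℕ → ℕ → ℤ) :
    colMoment G (w + 1) e = colMoment G w e + (w * ∑ r ∈ range G, e r w - total G w e) := by
  simp only [colMoment, total, moment_succ, sum_sub_distrib, sum_const, card_range, nsmul_eq_mul,
    sum_add_distrib, mul_sum]

/-- Twice the contribution to the sum of a block in row `r` and column `k` (counted from `0`) that
consists of the `x` largest residues below `s - r`, corrected by the term `x - x²`. -/
def blockGain (m s r k : ℕ) (x : ℤ) : ℤ := 2 * ((r * m + k) * s + s - 1 - r) * x - x ^ 2 + x

theorem sum_blockGain (m s G w k₀ : ℕ) (b : ℕ → ℕ → ℤ) :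
    ∑ r ∈ range G, ∑ k ∈ range w, blockGain m s r (k₀ + k) (b r k) =
      (m * s - 1) * rowMoment G w b + s * colMoment G w b +
        ((m * s - 1) * (G - 1) + s * (w - 1) + 2 * k₀ * s + 2 * s - 1) * total G w b -
        total G w fun r k => b r k ^ 2 := by
  simp only [rowMoment, colMoment, moment, centered, total, mul_sum, ← sum_add_distrib,
    ← sum_sub_distrib]
  refine sum_congr rfl fun r _ => sum_congr rfl fun k _ => ?_
  rw [blockGain]
  push_cast
  ring

/-- The optimal block sizes drop by `2` from each row to the next; subtracting this drop leaves
square terms with the constant coefficient `-1`. -/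
theorem three_mul_sum_blockGain_sub_centered (m s G w k₀ : ℕ) (c : ℕ → ℕ → ℤ) :
    3 * ∑ r ∈ range G, ∑ k ∈ range w, blockGain m s r (k₀ + k) (c r k - centered G r) =
      3 * ((m * s + 1) * rowMoment G w c + s * colMoment G w c +
        ((m * s - 1) * (G - 1) + s * (w - 1) + 2 * k₀ * s + 2 * s - 1) * total G w c -
        total G w fun r k => c r k ^ 2) - m * s * w * (G * (G ^ 2 - 1)) := by
  have hsq : total G w (fun r k => (c r k - centered G r) ^ 2) =
      total G w (fun r k => c r k ^ 2) - 2 * rowMoment G w c + w * moment G (centered G) := by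
    rw [← rowMoment_rows]
    simp only [total, rowMoment, moment, mul_sum, ← sum_sub_distrib, ← sum_add_distrib]
    exact sum_congr rfl fun r _ => sum_congr rfl fun k _ => by ring
  rw [sum_blockGain, hsq, total_sub, rowMoment_sub, colMoment_sub, total_rows, rowMoment_rows,
    colMoment_rows, sum_centered]
  linear_combination -(m * s * w) * three_mul_moment_centered G

/-- Twice the size of a set whose block in row `r` and column `k` consists of the `b r k` largest
residues that `𝓛_m(s)` admits there, when all its blocks lie in rows `< G`. -/
def arrayGain (m s G : ℕ) (b : ℕ → ℕ → ℤ) : ℤ :=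
  ∑ r ∈ range G, ∑ k ∈ range m, blockGain m s r k (b r k) - 2 * ∑ r ∈ range G, b r (m - 1)
    - total G m b ^ 2 + total G m b

theorem arrayGain_congr {s G : ℕ} {b b' : ℕ → ℕ → ℤ} (hm : 0 < m)
    (h : ∀ r < G, ∀ k < m, b r k = b' r k) : arrayGain m s G b = arrayGain m s G b' := by
  have hlast : ∀ r ∈ range G, b r (m - 1) = b' r (m - 1) := fun r hr =>
    h r (mem_range.1 hr) _ (by omega)
  have hblocks : ∀ r ∈ range G, ∀ k ∈ range m, b r k = b' r k := fun r hr k hk =>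
    h r (mem_range.1 hr) k (mem_range.1 hk)
  rw [arrayGain, arrayGain, total_congr h, sum_congr rfl hlast]
  congr 3
  exact sum_congr rfl fun r hr => sum_congr rfl fun k hk => by rw [hblocks r hr k hk]

theorem three_mul_arrayGain (m s G : ℕ) (Y : ℤ) (e : ℕ → ℕ → ℤ) :
    3 * arrayGain m s G (fun r k => Y - e r k - centered G r) =
      3 * ((m * s * G + s - G + 1) * (m * G * Y - total G m e)
        - (m * G * Y - total G m e) ^ 2 - m * G * Y ^ 2 + 2 * Y * total G m e
        - total G m (fun r k => e r k ^ 2) - 2 * (G * Y - ∑ r ∈ range G, e r (m - 1))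
        - (m * s + 1) * rowMoment G m e - s * colMoment G m e)
      - m ^ 2 * s * (G * (G ^ 2 - 1)) := by
  have hgain := three_mul_sum_blockGain_sub_centered m s G m 0 fun r k => Y - e r k
  simp only [zero_add, Nat.cast_zero] at hgain
  have htotal : total G m (fun r k => Y - e r k - centered G r) = m * G * Y - total G m e := by
    rw [total_sub, total_sub, total_const, total_rows G m (centered G), sum_centered]
    ring
  have hlast : ∑ r ∈ range G, (Y - e r (m - 1) - centered G r) =
      G * Y - ∑ r ∈ range G, e r (m - 1) := by
    rw [sum_sub_distrib, sum_centered, sub_zero, sum_sub_distrib, sum_const, card_range,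
      nsmul_eq_mul]
  have hsq : total G m (fun r k => (Y - e r k) ^ 2) =
      m * G * Y ^ 2 - 2 * Y * total G m e + total G m (fun r k => e r k ^ 2) := by
    simp only [total, sub_sq, sum_add_distrib, sum_sub_distrib, mul_sum, sum_const, card_range,
      nsmul_eq_mul]
    ring
  rw [rowMoment_sub, colMoment_sub, total_sub, hsq, total_const, rowMoment_const,
    colMoment_rows] at hgain
  rw [arrayGain, htotal, hlast]
  linear_combination hgain

/-- Three times the maximum of twice the size when `s = 2 * T`. -/
def evenMax (m T : ℕ) : ℤ := m * T ^ 2 * (m * T ^ 2 + 2 * m - 3)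

/-- Three times the maximum of twice the size when `s = 2 * T + 1`. -/
def oddMax (m T : ℕ) : ℤ := m ^ 2 * T * (T + 1) * (T ^ 2 + T + 1)

theorem three_mul_arrayGain_even (m T : ℕ) (e : ℕ → ℕ → ℤ) :
    3 * arrayGain m (2 * T) T (fun r k => 2 * T - 1 - 2 * r - e r k) =
      evenMax m T + 3 * (2 * (m - 1) * T ^ 2 + (T - 1) * total T m e - total T m e ^ 2
        - total T m (fun r k => e r k ^ 2) + 2 * ∑ r ∈ range T, e r (m - 1)
        - (2 * m * T + 1) * rowMoment T m e - 2 * T * colMoment T m e) := by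
  have h := three_mul_arrayGain m (2 * T) T T e
  have hb : (fun (r k : ℕ) => (T : ℤ) - e r k - centered T r) =
      fun (r k : ℕ) => 2 * (T : ℤ) - 1 - 2 * r - e r k := by
    funext r k; rw [centered]; ring
  rw [hb] at h
  rw [h, evenMax]
  push_cast
  ring

theorem three_mul_arrayGain_odd (m T : ℕ) (e : ℕ → ℕ → ℤ) :
    3 * arrayGain m (2 * T + 1) T (fun r k => 2 * T - 2 * r - e r k) =
      oddMax m T + 3 * ((m - 2) * T * (T + 1) + (m + 1) * T * total T m e - total T m e ^ 2
        - total T m (fun r k => e r k ^ 2) + 2 * ∑ r ∈ range T, e r (m - 1)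
        - (m * (2 * T + 1) + 1) * rowMoment T m e - (2 * T + 1) * colMoment T m e) := by
  have h := three_mul_arrayGain m (2 * T + 1) T (T + 1) e
  have hb : (fun (r k : ℕ) => (T + 1 : ℤ) - e r k - centered T r) =
      fun (r k : ℕ) => 2 * (T : ℤ) - 2 * r - e r k := by
    funext r k; rw [centered]; ring
  rw [hb] at h
  rw [h, oddMax]
  push_cast
  ring

end Gain

section SizeArray

/-- An array of block sizes with `R` full rows of nonempty blocks, followed by a row in which
exactly the first `p` blocks are nonempty. The fields `cap` and `cap_last` bound the size of a block
by the number of residues that `𝓛_m(s)` admits there. -/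
structure IsSizeArray (m s T R p : ℕ) (b : ℕ → ℕ → ℤ) : Prop where
  p_lt : p < m
  size_pos : 0 < R * m + p
  size_le : R * m + p ≤ T * m
  pos : ∀ r k, r < R → k < m → 0 < b r k
  pos_last : ∀ k, k < p → 0 < b R k
  zero_last : ∀ k, p ≤ k → k < m → b R k = 0
  zero : ∀ r k, R < r → k < m → b r k = 0
  row : ∀ r, AntitoneOn (b r) (Set.Iio m)
  col : ∀ r k, k < m → 0 < b (r + 1) k → b (r + 1) k + 2 ≤ b r k
  cap : ∀ r k, r < T → k + 1 < m → b r k ≤ s - 1 - 2 * r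
  cap_last : ∀ r, r < T → b r (m - 1) ≤ s - 2 - 2 * r

variable {m s T R p : ℕ} {b : ℕ → ℕ → ℤ}

theorem IsSizeArray.R_le (h : IsSizeArray m s T R p b) : R ≤ T :=
  Nat.le_of_mul_le_mul_right ((Nat.le_add_right _ p).trans h.size_le) (by have := h.p_lt; omega)

theorem IsSizeArray.R_lt (h : IsSizeArray m s T R p b) (hp : 0 < p) : R < T :=
  Nat.lt_of_mul_lt_mul_right ((Nat.lt_add_of_pos_right hp).trans_le h.size_le)

theorem sum_range_eq_of_zero {f : ℕ → ℤ} {a c : ℕ} (hac : a ≤ c) (h : ∀ i, a ≤ i → f i = 0) :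
    ∑ i ∈ range c, f i = ∑ i ∈ range a, f i := by
  refine (sum_subset (range_subset_range.2 hac) fun i _ hi => h i ?_).symm
  simpa using hi

theorem IsSizeArray.total_eq (h : IsSizeArray m s T R p b) {f : ℕ → ℕ → ℤ}
    (hf : ∀ r k, k < m → b r k = 0 → f r k = 0) :
    total T m f = total (R + 1) p f + total R (m - p) fun r k => f r (p + k) := by
  have hsplit (r : ℕ) : ∑ k ∈ range m, f r k =
      ∑ k ∈ range p, f r k + ∑ k ∈ range (m - p), f r (p + k) := by
    rw [← sum_range_add, Nat.add_sub_cancel' h.p_lt.le]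
  simp only [total, hsplit, sum_add_distrib]
  congr 1
  · rcases Nat.eq_zero_or_pos p with rfl | hp
    · simp
    · refine sum_range_eq_of_zero (h.R_lt hp) fun r hr => sum_eq_zero fun k hk => ?_
      have hk' : k < m := (mem_range.1 hk).trans h.p_lt
      exact hf r k hk' (h.zero r k hr hk')
  · refine sum_range_eq_of_zero h.R_le fun r hr => sum_eq_zero fun k hk => ?_
    have hk' : p + k < m := by have := mem_range.1 hk; omega
    refine hf r _ hk' ?_
    rcases hr.eq_or_lt with rfl | hr
    · exact h.zero_last _ (by omega) hk'
    · exact h.zero r _ hr hk'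

theorem IsSizeArray.sum_last_eq (h : IsSizeArray m s T R p b) :
    ∑ r ∈ range T, b r (m - 1) = ∑ r ∈ range R, b r (m - 1) := by
  have := h.p_lt
  refine sum_range_eq_of_zero h.R_le fun r hr => ?_
  rcases hr.eq_or_lt with rfl | hr
  · exact h.zero_last _ (by omega) (by omega)
  · exact h.zero r _ hr (by omega)

theorem IsSizeArray.antitoneOn_row (h : IsSizeArray m s T R p b) (r a n : ℕ) (ha : a + n ≤ m) :
    AntitoneOn (fun k => b r (a + k)) (Set.Iio n) := fun k hk l hl hkl =>
  h.row r (by simp only [Set.mem_Iio] at hk ⊢; omega) (by simp only [Set.mem_Iio] at hl ⊢; omega)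
    (by omega)

theorem IsSizeArray.pos_of_lt (h : IsSizeArray m s T R p b) {r k n : ℕ} (hk : k < m)
    (hn : n ≤ R + 1) (hp : n = R + 1 → k < p) (hr : r < n) : 0 < b r k := by
  rcases Nat.lt_or_ge r R with hrR | hrR
  · exact h.pos r k hrR hk
  · obtain rfl : r = R := by omega
    exact h.pos_last k (hp (by omega))

/-- Along a column of nonempty blocks, adding the drop by `2` from each row to the next leaves a
decreasing sequence. -/
theorem IsSizeArray.antitoneOn_col (h : IsSizeArray m s T R p b) {k n : ℕ} (hk : k < m)
    (hn : n ≤ R + 1) (hp : n = R + 1 → k < p) :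
    AntitoneOn (fun r => b r k + centered n r) (Set.Iio n) := by
  refine antitoneOn_of_add_one_le Set.ordConnected_Iio fun r _ _ hr => ?_
  have hdrop := h.col r k hk (h.pos_of_lt hk hn hp hr)
  simp only [centered]
  push_cast
  linarith

theorem IsSizeArray.le_of_column (h : IsSizeArray m s T R p b) {r k n : ℕ} (hk : k < m)
    (hn : n ≤ R + 1) (hp : n = R + 1 → k < p) (hr : r < n) : 2 * ((n : ℤ) - r) - 1 ≤ b r k := by
  have hlast : n - 1 < n := by omega
  have hle := h.antitoneOn_col hk hn hp hr hlast (Nat.le_sub_one_of_lt hr)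
  have hpos := h.pos_of_lt hk hn hp hlast
  simp only [centered] at hle
  push_cast [Nat.cast_sub (Nat.one_le_of_lt hr)] at hle
  linarith

end SizeArray

section RelaxedBound

variable {m s T R p : ℕ} {b c : ℕ → ℕ → ℤ}

theorem three_mul_sum_blockGain_le (m s k₀ : ℕ) {G w : ℕ}
    (hrow : ∀ r < G, AntitoneOn (b r) (Set.Iio w))
    (hcol : ∀ k < w, AntitoneOn (fun r => b r k + centered G r) (Set.Iio G)) :
    3 * ∑ r ∈ range G, ∑ k ∈ range w, blockGain m s r (k₀ + k) (b r k) ≤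
      3 * (((m * s - 1) * (G - 1) + s * (w - 1) + 2 * k₀ * s + 2 * s - 1) *
        total G w (fun r k => b r k + centered G r) -
        total G w fun r k => (b r k + centered G r) ^ 2) - m * s * w * (G * (G ^ 2 - 1)) := by
  have hrowMoment : rowMoment G w (fun r k => b r k + centered G r) ≤ 0 := rowMoment_nonpos hcol
  have hcolMoment : colMoment G w (fun r k => b r k + centered G r) ≤ 0 :=
    colMoment_nonpos fun r hr => (hrow r hr).add_const _
  have hgain := three_mul_sum_blockGain_sub_centered m s G w k₀ fun r k => b r k + centered G r
  simp only [add_sub_cancel_right] at hgain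
  have hrow_le := mul_nonpos_of_nonneg_of_nonpos (by positivity : (0 : ℤ) ≤ m * s + 1) hrowMoment
  have hcol_le := mul_nonpos_of_nonneg_of_nonpos (Nat.cast_nonneg (α := ℤ) s) hcolMoment
  linarith

theorem four_mul_total_sub_le (G w : ℕ) (x : ℤ) (c : ℕ → ℕ → ℤ) :
    4 * (x * total G w c - total G w fun r k => c r k ^ 2) ≤ G * w * x ^ 2 := by
  rw [← total_const G w (x ^ 2)]
  simp only [total, mul_sum, ← sum_sub_distrib]
  exact sum_le_sum fun r _ => sum_le_sum fun k _ => by linarith [sq_nonneg (x - 2 * c r k)]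

theorem four_mul_total_sub_last_le (G u : ℕ) (x : ℤ) (c : ℕ → ℕ → ℤ) :
    4 * (x * total G (u + 1) c - total G (u + 1) (fun r k => c r k ^ 2)
      - 2 * ∑ r ∈ range G, c r u) ≤ G * (u * x ^ 2 + (x - 2) ^ 2) := by
  have hlast := four_mul_total_sub_le G 1 (x - 2) fun r _ => c r u
  have hrest := four_mul_total_sub_le G u x c
  rw [total_rows, total_rows, Nat.cast_one, one_mul, one_mul] at hlast
  rw [total_succ_right, total_succ_right]
  linarith

/-- The relaxation to real block sizes: all block sizes are replaced by the maxima of the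
quadratic polynomials that remain after the monotonicity constraints have been used. -/
theorem IsSizeArray.arrayGain_le (h : IsSizeArray m s T R p b) :
    12 * arrayGain m s T b ≤
      3 * (R * m + p) * (R * m + p + 1) * s ^ 2 - 6 * (R * m + p) * s * R +
        6 * (m - p - 2) * R * s - 4 * m * s * R * (m * (R ^ 2 - 1) + 3 * p * (R + 1)) +
        3 * R ^ 2 + 3 * (m - p) * R := by
  obtain ⟨u, rfl⟩ : ∃ u, m = p + (u + 1) := ⟨m - p - 1, by have := h.p_lt; omega⟩
  have hgain := h.total_eq (f := fun r k => blockGain (p + (u + 1)) s r k (b r k))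
    fun r k _ hb => by simp [blockGain, hb]
  have htotal := h.total_eq (f := b) fun r k _ hb => hb
  rw [Nat.add_sub_cancel_left] at hgain htotal
  have hleft := three_mul_sum_blockGain_le (p + (u + 1)) s 0 (G := R + 1) (w := p) (b := b)
    (fun r _ => by simpa using h.antitoneOn_row r 0 p (by omega))
    fun k hk => h.antitoneOn_col (by omega) le_rfl fun _ => hk
  have hright := three_mul_sum_blockGain_le (p + (u + 1)) s p (G := R) (w := u + 1)
    (b := fun r k => b r (p + k)) (fun r _ => h.antitoneOn_row r p (u + 1) le_rfl)
    fun k hk => h.antitoneOn_col (by omega) (by omega) (by omega)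
  have hleft_sq := four_mul_total_sub_le (R + 1) p s fun r k => b r k + centered (R + 1) r
  have hright_sq := four_mul_total_sub_last_le R u (s + 1) fun r k => b r (p + k) + centered R r
  have hlast : ∑ r ∈ range T, b r (p + (u + 1) - 1) =
      ∑ r ∈ range R, (b r (p + u) + centered R r) := by
    rw [h.sum_last_eq, sum_add_distrib, sum_centered, add_zero, ← add_assoc, Nat.add_sub_cancel]
  have hN := sq_nonneg (2 * (total (R + 1) p b + total R (u + 1) fun r k => b r (p + k)) -
    ((R * (p + (u + 1)) + p) * s - R) : ℤ)
  simp only [zero_add] at hleft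
  rw [total_add_centered] at hleft hright hleft_sq hright_sq
  rw [total, total, total] at hgain
  rw [arrayGain, hgain, htotal, hlast]
  push_cast at *
  linarith

end RelaxedBound

section StrictBounds

variable {m T R p : ℕ} {b : ℕ → ℕ → ℤ}

theorem IsSizeArray.lt_evenMax_of_add_two_le (h : IsSizeArray m (2 * T) T R p b) (hm : 2 ≤ m)
    (hR : R + 2 ≤ T) : 3 * arrayGain m (2 * T) T b < evenMax m T := by
  suffices 0 < 4 * evenMax m T - 12 * arrayGain m (2 * T) T b by linarith
  refine lt_of_lt_of_le ?_ (sub_le_sub_left h.arrayGain_le _)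
  -- The substitutions turn the gap to the maximum into a polynomial in natural numbers all of whose
  -- coefficients are positive.
  obtain ⟨x, rfl⟩ := Nat.exists_eq_add_of_le hR
  have hp := h.p_lt
  rcases Nat.eq_zero_or_pos p with rfl | hp0
  · obtain ⟨v, rfl⟩ := Nat.exists_eq_add_of_le hm
    rw [evenMax]; push_cast; ring_nf; positivity
  · obtain ⟨q, rfl⟩ := Nat.exists_eq_add_of_le (Nat.succ_le_of_lt hp0)
    obtain ⟨v, rfl⟩ := Nat.exists_eq_add_of_le (Nat.succ_le_of_lt hp)
    rw [evenMax]; push_cast; ring_nf; positivity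

theorem IsSizeArray.lt_evenMax_of_last_row (h : IsSizeArray m (2 * T) T R p b)
    (hR : R + 1 = T) (hp : 0 < p) (hpm : p + 2 ≤ m) :
    3 * arrayGain m (2 * T) T b < evenMax m T := by
  suffices 0 < 4 * evenMax m T - 12 * arrayGain m (2 * T) T b by linarith
  refine lt_of_lt_of_le ?_ (sub_le_sub_left h.arrayGain_le _)
  subst hR
  obtain ⟨q, rfl⟩ := Nat.exists_eq_add_of_le (Nat.succ_le_of_lt hp)
  obtain ⟨v, rfl⟩ := Nat.exists_eq_add_of_le hpm
  rw [evenMax]; push_cast; ring_nf; positivity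

theorem IsSizeArray.lt_oddMax_of_add_two_le (h : IsSizeArray m (2 * T + 1) T R p b) (hm : 2 ≤ m)
    (hR : R + 2 ≤ T) : 3 * arrayGain m (2 * T + 1) T b < oddMax m T := by
  suffices 0 < 4 * oddMax m T - 12 * arrayGain m (2 * T + 1) T b by linarith
  refine lt_of_lt_of_le ?_ (sub_le_sub_left h.arrayGain_le _)
  obtain ⟨x, rfl⟩ := Nat.exists_eq_add_of_le hR
  have hp := h.p_lt
  rcases Nat.eq_zero_or_pos p with rfl | hp0
  · obtain ⟨v, rfl⟩ := Nat.exists_eq_add_of_le hm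
    rw [oddMax]; push_cast; ring_nf; positivity
  · obtain ⟨q, rfl⟩ := Nat.exists_eq_add_of_le (Nat.succ_le_of_lt hp0)
    obtain ⟨v, rfl⟩ := Nat.exists_eq_add_of_le (Nat.succ_le_of_lt hp)
    rw [oddMax]; push_cast; ring_nf; positivity

theorem IsSizeArray.lt_oddMax_of_empty_last_row (h : IsSizeArray m (2 * T + 1) T R 0 b)
    (hm : 2 ≤ m) (hR : R + 1 = T) : 3 * arrayGain m (2 * T + 1) T b < oddMax m T := by
  suffices 0 < 4 * oddMax m T - 12 * arrayGain m (2 * T + 1) T b by linarith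
  refine lt_of_lt_of_le ?_ (sub_le_sub_left h.arrayGain_le _)
  subst hR
  obtain ⟨v, rfl⟩ := Nat.exists_eq_add_of_le hm
  rw [oddMax]; push_cast; ring_nf; positivity

end StrictBounds

section EmptyLastRow

variable {m s T R : ℕ} {b : ℕ → ℕ → ℤ}

theorem IsSizeArray.arrayGain_eq_of_empty_last_row (h : IsSizeArray m s T R 0 b) :
    arrayGain m s T b = arrayGain m s R b := by
  have hgain := h.total_eq (f := fun r k => blockGain m s r k (b r k))
    fun r k _ hb => by simp [blockGain, hb]
  have htotal := h.total_eq (f := b) fun r k _ hb => hb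
  simp only [total, range_zero, sum_empty, sum_const_zero, zero_add, Nat.sub_zero] at hgain htotal
  rw [arrayGain, arrayGain, total, total, hgain, htotal, h.sum_last_eq]

theorem two_mul_sum_last_le (R w : ℕ) (e : ℕ → ℕ → ℤ) :
    2 * ∑ r ∈ range R, e r w ≤
      total R (w + 1) (fun r k => e r k ^ 2) + total R (w + 1) e := by
  have hsq (x : ℤ) : 0 ≤ x ^ 2 + x := by
    rcases le_or_gt 0 x with hx | hx
    · positivity
    · nlinarith
  have hrow (r : ℕ) : 2 * e r w ≤ ∑ k ∈ range (w + 1), (e r k ^ 2 + e r k) := by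
    rw [sum_range_succ]
    linarith [sum_nonneg fun k (_ : k ∈ range w) => hsq (e r k), hsq (-e r w)]
  rw [mul_sum, total, total, ← sum_add_distrib]
  exact sum_le_sum fun r _ => (hrow r).trans_eq sum_add_distrib

theorem IsSizeArray.lt_evenMax_of_empty_last_row (h : IsSizeArray m (2 * T) T R 0 b)
    (hm : 2 ≤ m) (hR : R + 1 = T) : 3 * arrayGain m (2 * T) T b < evenMax m T := by
  have hRpos : 0 < R := Nat.pos_of_mul_pos_right h.size_pos
  obtain ⟨w, rfl⟩ := Nat.exists_eq_add_of_le' hm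
  set e : ℕ → ℕ → ℤ := fun r k => T - (b r k + centered R r) with he
  have hb : b = fun r k => T - e r k - centered R r := by
    funext r k; simp only [he]; ring
  have hcol (k) (hk : k < w + 2) : MonotoneOn (e · k) (Set.Iio R) := fun r hr r' hr' hrr =>
    sub_le_sub_left (h.antitoneOn_col hk R.le_succ (by omega) hr hr' hrr) _
  have hcolMoment : 0 ≤ colMoment R (w + 2) e := colMoment_nonneg fun r _ k hk l hl hkl =>
    sub_le_sub_left (add_le_add_left (h.row r hk hl hkl) _) _
  have hrowMoment : 0 ≤ rowMoment R (w + 2) e := rowMoment_nonneg hcol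
  have hmoment : total R (w + 2) e * (R - total R (w + 2) e) ≤ rowMoment R (w + 2) e :=
    mul_sub_le_moment fun _ hr _ hr' hrr =>
      sum_le_sum fun k hk => hcol k (mem_range.1 hk) hr hr' hrr
  have hlast := two_mul_sum_last_le R (w + 1) e
  have hgain := three_mul_arrayGain (w + 2) (2 * T) R T e
  rw [← hb] at hgain
  rw [h.arrayGain_eq_of_empty_last_row, hgain, evenMax, ← hR]
  have hc := mul_nonneg (by positivity : (0 : ℤ) ≤ 2 * T) hcolMoment
  have hr := mul_nonneg (by positivity : (0 : ℤ) ≤ 2 * (w + 2) * T) hrowMoment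
  have hgap : (0 : ℤ) < w * ((w + 1) * (R + 1) ^ 2 + (R + 1)) + (w + 2) * (R + 1) := by positivity
  push_cast [← hR] at *
  linarith

end EmptyLastRow

section FullColumns

variable {m T R p : ℕ} {b : ℕ → ℕ → ℤ}

theorem three_mul_arrayGain_of_full_columns (w T : ℕ)
    (hb : ∀ r < T, ∀ k < w, b r k = 2 * T - 1 - 2 * r) {c : ℕ → ℤ}
    (hlast : ∀ r < T, b r w = 2 * T - 1 - 2 * r - c r) :
    3 * arrayGain (w + 1) (2 * T) T b = evenMax (w + 1) T +
      3 * (2 * w * T ^ 2 + (T + 1 - 2 * T * w) * ∑ r ∈ range T, c r - (∑ r ∈ range T, c r) ^ 2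
        - ∑ r ∈ range T, c r ^ 2 - (2 * (w + 1) * T + 1) * moment T c) := by
  set e : ℕ → ℕ → ℤ := fun r k => if k < w then 0 else c r with he
  have heb : arrayGain (w + 1) (2 * T) T b =
      arrayGain (w + 1) (2 * T) T fun r k => 2 * T - 1 - 2 * r - e r k := by
    refine arrayGain_congr w.succ_pos fun r hr k hk => ?_
    rcases (Nat.lt_succ_iff.1 hk).lt_or_eq with hk | rfl
    · simpa [he, hk] using hb r hr k hk
    · simpa [he] using hlast r hr
  have he0 (r) (_ : r < T) (k) (hk : k < w) : e r k = 0 := if_pos hk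
  have hew (r : ℕ) : e r w = c r := if_neg (lt_irrefl w)
  have hsq0 (r) (hr : r < T) (k) (hk : k < w) : e r k ^ 2 = 0 := by
    rw [he0 r hr k hk, sq, zero_mul]
  rw [heb, three_mul_arrayGain_even, total_succ_right, total_succ_right, rowMoment_succ_right,
    colMoment_succ_right, total_congr he0, total_congr hsq0, rowMoment_congr he0,
    colMoment_congr he0, total_const, rowMoment_const, colMoment_rows]
  simp only [hew, Nat.add_sub_cancel]
  push_cast
  ring

theorem three_mul_arrayGain_of_full_columns_of_zero (w R : ℕ)
    (hb : ∀ r < R + 1, ∀ k < w, b r k = 2 * R + 1 - 2 * r) {d : ℕ → ℤ}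
    (hlast : ∀ r < R, b r w = 2 * R - 2 * r - d r) (hzero : b R w = 0) :
    3 * arrayGain (w + 1) (2 * (R + 1)) (R + 1) b = evenMax (w + 1) (R + 1) +
      3 * ((∑ r ∈ range R, d r) * (R - ∑ r ∈ range R, d r) - (∑ r ∈ range R, (d r ^ 2 - d r)
        + (2 * (w + 1) * (R + 1) + 1) * moment R d)) := by
  set c : ℕ → ℤ := fun r => 2 * R + 1 - 2 * r - b r w with hc
  have hcR : c R = 1 := by simp only [hc, hzero]; ring
  have hcd (r) (hr : r ∈ range R) : c r = 1 + d r := by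
    simp only [hc, hlast r (mem_range.1 hr)]; ring
  have hsum : ∑ r ∈ range R, c r = R + ∑ r ∈ range R, d r := by
    rw [sum_congr rfl hcd, sum_add_distrib, sum_const, card_range, nsmul_eq_mul, mul_one]
  have hsq : ∑ r ∈ range R, c r ^ 2 =
      R + 3 * ∑ r ∈ range R, d r + ∑ r ∈ range R, (d r ^ 2 - d r) := by
    have hexpand (r) (hr : r ∈ range R) : c r ^ 2 = 1 + 3 * d r + (d r ^ 2 - d r) := by
      rw [hcd r hr]; ring
    rw [sum_congr rfl hexpand, sum_add_distrib, sum_add_distrib, sum_const, card_range,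
      nsmul_eq_mul, mul_one, mul_sum]
  have hmoment : moment (R + 1) c = moment R d - ∑ r ∈ range R, d r := by
    have hcd' : moment R c = moment R d := by
      rw [moment_congr fun r hr => (hcd r (mem_range.2 hr)).trans (sub_neg_eq_add 1 (d r)).symm,
        moment_sub, moment_const]
      simp [moment]
    rw [moment_succ, hcR, sum_sub_distrib, hsum, sum_const, card_range, nsmul_eq_mul, hcd']
    ring
  have key := three_mul_arrayGain_of_full_columns (b := b) (c := c) w (R + 1)
    (fun r hr k hk => by rw [hb r hr k hk]; push_cast; ring)
    (fun r _ => by simp only [hc]; push_cast; ring)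
  rw [key, sum_range_succ, sum_range_succ, hcR, hsum, hsq, hmoment]
  push_cast
  ring

theorem IsSizeArray.eq_of_full_column (h : IsSizeArray m (2 * (R + 1)) (R + 1) R p b) {r k : ℕ}
    (hr : r < R + 1) (hk : k < p) : b r k = 2 * R + 1 - 2 * r := by
  have hp := h.p_lt
  have hge := h.le_of_column (hk.trans hp) le_rfl (fun _ => hk) hr
  have hle := h.cap r k hr (by omega)
  push_cast at *
  linarith

theorem IsSizeArray.three_mul_arrayGain_lastColumn
    (h : IsSizeArray (p + 1) (2 * (R + 1)) (R + 1) R p b)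
    {d : ℕ → ℤ} (hd : ∀ r, d r = 2 * R - 2 * r - b r p) :
    3 * arrayGain (p + 1) (2 * (R + 1)) (R + 1) b = evenMax (p + 1) (R + 1) +
      3 * ((∑ r ∈ range R, d r) * (R - ∑ r ∈ range R, d r) - (∑ r ∈ range R, (d r ^ 2 - d r)
        + (2 * (p + 1) * (R + 1) + 1) * moment R d)) :=
  three_mul_arrayGain_of_full_columns_of_zero p R (fun _ hr _ hk => h.eq_of_full_column hr hk)
    (fun r _ => by rw [hd]; ring) (h.zero_last p le_rfl p.lt_succ_self)

theorem IsSizeArray.monotoneOn_lastColumn (h : IsSizeArray (p + 1) (2 * (R + 1)) (R + 1) R p b)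
    {d : ℕ → ℤ} (hd : ∀ r, d r = 2 * R - 2 * r - b r p) : MonotoneOn d (Set.Iio R) := by
  intro r hr r' hr' hrr
  have hle := h.antitoneOn_col p.lt_succ_self R.le_succ (by omega) hr hr' hrr
  simp only [centered] at hle
  rw [hd, hd]
  linarith

theorem IsSizeArray.le_evenMax (h : IsSizeArray (p + 1) (2 * (R + 1)) (R + 1) R p b) :
    3 * arrayGain (p + 1) (2 * (R + 1)) (R + 1) b ≤ evenMax (p + 1) (R + 1) := by
  have hle := mul_sub_le_sum_add_mul_moment (K := 2 * (p + 1) * (R + 1) + 1)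
    (le_add_of_nonneg_left (by positivity)) (h.monotoneOn_lastColumn fun _ => rfl)
  rw [h.three_mul_arrayGain_lastColumn fun _ => rfl]
  linarith

theorem IsSizeArray.lastColumn_eq_of_eq_evenMax
    (h : IsSizeArray (p + 1) (2 * (R + 1)) (R + 1) R p b)
    (heq : 3 * arrayGain (p + 1) (2 * (R + 1)) (R + 1) b = evenMax (p + 1) (R + 1)) :
    (∀ r < R, b r p = 2 * R - 2 * r) ∨ ∀ r < R, b r p = 2 * R - 2 * r - 1 := by
  rw [h.three_mul_arrayGain_lastColumn fun _ => rfl] at heq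
  have hd := eq_zero_or_eq_one_of_mul_sub_eq (K := 2 * (p + 1) * (R + 1) + 1)
    (lt_add_of_pos_left 1 (by positivity)) (h.monotoneOn_lastColumn fun _ => rfl) (by linarith)
  exact hd.imp (fun hd r hr => by linarith [hd r hr]) fun hd r hr => by linarith [hd r hr]

end FullColumns

section FullRows

variable {m s T R p w : ℕ} {b τ : ℕ → ℕ → ℤ}

/-- `τ` marks the blocks that are one short of being full. The subtracted term accounts for the
largest admissible element, which such a block cannot contain. -/
theorem three_mul_arrayGain_of_full_rows (hτ : ∀ r < T, ∀ k < w, τ r k ^ 2 = τ r k)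
    (hb : ∀ r < T, ∀ k < w, b r k = 2 * T - 2 * r - τ r k)
    (hlast : ∀ r < T, b r w = 2 * T - 2 * r - 1) :
    3 * (arrayGain (w + 1) (2 * T + 1) T b - 2 * total T w fun r k => τ r k * b r k) =
      oddMax (w + 1) T + 3 * (total T w τ * (T * w - total T w τ)
        - ((w + 1) * (2 * T + 1) - 1) * rowMoment T w τ - (2 * T + 1) * colMoment T w τ) := by
  set e : ℕ → ℕ → ℤ := fun r k => if k < w then τ r k else 1 with he
  have heb : arrayGain (w + 1) (2 * T + 1) T b =
      arrayGain (w + 1) (2 * T + 1) T fun r k => 2 * T - 2 * r - e r k := by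
    refine arrayGain_congr w.succ_pos fun r hr k hk => ?_
    rcases (Nat.lt_succ_iff.1 hk).lt_or_eq with hk | rfl
    · simpa [he, hk] using hb r hr k hk
    · simpa [he] using hlast r hr
  have heτ (r) (_ : r < T) (k) (hk : k < w) : e r k = τ r k := if_pos hk
  have hew (r : ℕ) : e r w = 1 := if_neg (lt_irrefl w)
  have hsq (r) (hr : r < T) (k) (hk : k < w) : e r k ^ 2 = τ r k := by
    rw [heτ r hr k hk, hτ r hr k hk]
  have hlost : (total T w fun r k => τ r k * b r k) = T * total T w τ - rowMoment T w τ := by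
    simp only [total, rowMoment, moment, mul_sum, ← sum_sub_distrib]
    refine sum_congr rfl fun r hr => sum_congr rfl fun k hk => ?_
    rw [hb r (mem_range.1 hr) k (mem_range.1 hk), centered]
    linear_combination -(hτ r (mem_range.1 hr) k (mem_range.1 hk))
  rw [mul_sub, heb, three_mul_arrayGain_odd, hlost, total_succ_right, total_succ_right,
    rowMoment_succ_right, colMoment_succ_right, total_congr heτ, total_congr hsq,
    rowMoment_congr heτ, colMoment_congr heτ]
  simp only [hew, Nat.add_sub_cancel, moment_const, one_pow, sum_const, card_range, nsmul_eq_mul]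
  push_cast
  ring

/-- The number of elements by which each block falls short of its capacity, for `s = 2 * T + 1`. -/
def shortfall (T : ℕ) (b : ℕ → ℕ → ℤ) (r k : ℕ) : ℤ := 2 * T - 2 * r - b r k

theorem IsSizeArray.one_le_shortfall_last (h : IsSizeArray (w + 1) (2 * T + 1) T R p b) {r : ℕ}
    (hr : r < T) : 1 ≤ shortfall T b r w := by
  have hcap := h.cap_last r hr
  rw [Nat.add_sub_cancel] at hcap
  push_cast at hcap
  rw [shortfall]
  linarith

theorem IsSizeArray.shortfall_nonneg (h : IsSizeArray (w + 1) (2 * T + 1) T R p b) (r : ℕ)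
    (hr : r < T) (k : ℕ) (hk : k < w + 1) : 0 ≤ shortfall T b r k := by
  rcases (Nat.lt_succ_iff.1 hk).lt_or_eq with hkw | rfl
  · have hcap := h.cap r k hr (Nat.succ_lt_succ hkw)
    push_cast at hcap
    rw [shortfall]
    linarith
  · exact zero_le_one.trans (h.one_le_shortfall_last hr)

theorem IsSizeArray.shortfall_le (h : IsSizeArray m s T R p b) {r k n : ℕ} (hk : k < m)
    (hn : n ≤ R + 1) (hp : n = R + 1 → k < p) (hr : r < n) :
    shortfall T b r k ≤ 2 * (T - n) + 1 := by
  rw [shortfall]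
  linarith [h.le_of_column hk hn hp hr]

theorem IsSizeArray.monotoneOn_shortfall_row (h : IsSizeArray m s T R p b) (r : ℕ) :
    MonotoneOn (shortfall T b r) (Set.Iio m) := fun _ hk _ hl hkl =>
  sub_le_sub_left (h.row r hk hl hkl) _

theorem IsSizeArray.monotoneOn_shortfall_col (h : IsSizeArray m s T R p b) {k n : ℕ} (hk : k < m)
    (hn : n ≤ R + 1) (hp : n = R + 1 → k < p) :
    MonotoneOn (shortfall T b · k) (Set.Iio n) := by
  intro r hr r' hr' hrr
  have hle := h.antitoneOn_col hk hn hp hr hr' hrr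
  simp only [centered] at hle
  simp only [shortfall]
  linarith

theorem IsSizeArray.shortfall_le_one (h : IsSizeArray (w + 1) (2 * T + 1) T T 0 b) (r : ℕ)
    (hr : r < T) (k : ℕ) (hk : k < w) : shortfall T b r k ≤ 1 := by
  simpa using h.shortfall_le (hk.trans w.lt_succ_self) T.le_succ (by omega) hr

theorem IsSizeArray.shortfall_sq (h : IsSizeArray (w + 1) (2 * T + 1) T T 0 b) (r : ℕ)
    (hr : r < T) (k : ℕ) (hk : k < w) : shortfall T b r k ^ 2 = shortfall T b r k := by
  have h0 := h.shortfall_nonneg r hr k (hk.trans w.lt_succ_self)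
  have h1 := h.shortfall_le_one r hr k hk
  interval_cases shortfall T b r k <;> rfl

theorem IsSizeArray.shortfall_row (h : IsSizeArray (w + 1) (2 * T + 1) T T 0 b) (r : ℕ) :
    MonotoneOn (shortfall T b r) (Set.Iio w) :=
  (h.monotoneOn_shortfall_row r).mono (Set.Iio_subset_Iio w.le_succ)

theorem IsSizeArray.shortfall_col (h : IsSizeArray (w + 1) (2 * T + 1) T T 0 b) (k : ℕ)
    (hk : k < w) : MonotoneOn (shortfall T b · k) (Set.Iio T) :=
  h.monotoneOn_shortfall_col (hk.trans w.lt_succ_self) T.le_succ (by omega)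

theorem IsSizeArray.lastColumn_eq (h : IsSizeArray (w + 1) (2 * T + 1) T T 0 b) {r : ℕ}
    (hr : r < T) : b r w = 2 * T - 2 * r - 1 := by
  have hge := h.one_le_shortfall_last hr
  have hle := h.shortfall_le w.lt_succ_self T.le_succ (by omega) hr
  rw [shortfall] at hge hle
  linarith

theorem IsSizeArray.total_shortfall_mul_le (h : IsSizeArray (w + 1) (2 * T + 1) T T 0 b) :
    total T w (shortfall T b) * (T * w - total T w (shortfall T b)) ≤
      w * rowMoment T w (shortfall T b) + T * colMoment T w (shortfall T b) :=
  total_mul_sub_total_le (fun r hr k hk => h.shortfall_nonneg r hr k (hk.trans w.lt_succ_self))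
    h.shortfall_le_one (fun r _ => h.shortfall_row r) h.shortfall_col

theorem IsSizeArray.three_mul_arrayGain_shortfall (h : IsSizeArray (w + 1) (2 * T + 1) T T 0 b) :
    3 * (arrayGain (w + 1) (2 * T + 1) T b -
      2 * total T w fun r k => shortfall T b r k * b r k) =
      oddMax (w + 1) T + 3 * (total T w (shortfall T b) * (T * w - total T w (shortfall T b))
        - ((w + 1) * (2 * T + 1) - 1) * rowMoment T w (shortfall T b)
        - (2 * T + 1) * colMoment T w (shortfall T b)) :=
  three_mul_arrayGain_of_full_rows h.shortfall_sq
    (fun r _ k _ => by rw [shortfall]; ring) fun _ hr => h.lastColumn_eq hr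

theorem IsSizeArray.le_oddMax (h : IsSizeArray (w + 1) (2 * T + 1) T T 0 b) :
    3 * (arrayGain (w + 1) (2 * T + 1) T b -
      2 * total T w fun r k => shortfall T b r k * b r k) ≤ oddMax (w + 1) T := by
  have hiso := h.total_shortfall_mul_le
  have hrow := mul_nonneg (by positivity : (0 : ℤ) ≤ 2 * T * (w + 1))
    (rowMoment_nonneg h.shortfall_col)
  have hcol := mul_nonneg (by positivity : (0 : ℤ) ≤ T + 1)
    (colMoment_nonneg fun r (_ : r < T) => h.shortfall_row r)
  rw [h.three_mul_arrayGain_shortfall]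
  linarith

theorem IsSizeArray.shortfall_eq_of_eq_oddMax (h : IsSizeArray (w + 1) (2 * T + 1) T T 0 b)
    (heq : 3 * (arrayGain (w + 1) (2 * T + 1) T b -
      2 * total T w fun r k => shortfall T b r k * b r k) = oddMax (w + 1) T) :
    (∀ r < T, ∀ k < w, shortfall T b r k = 0) ∨ ∀ r < T, ∀ k < w, shortfall T b r k = 1 := by
  have hiso := h.total_shortfall_mul_le
  have hrow := rowMoment_nonneg h.shortfall_col
  have hcol := colMoment_nonneg fun r (_ : r < T) => h.shortfall_row r
  have hTpos : (0 : ℤ) < T := by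
    have := h.size_pos
    exact_mod_cast Nat.pos_of_mul_pos_right this
  rw [h.three_mul_arrayGain_shortfall] at heq
  have hrow0 : rowMoment T w (shortfall T b) = 0 := by
    nlinarith [mul_nonneg (by positivity : (0 : ℤ) ≤ T + 1) hcol,
      mul_nonneg (by positivity : (0 : ℤ) ≤ 2 * T * w) hrow]
  rw [hrow0] at heq hiso
  have hcol0 : colMoment T w (shortfall T b) = 0 := by nlinarith
  rw [hcol0] at heq
  have hprod : total T w (shortfall T b) * (T * w - total T w (shortfall T b)) = 0 := by linarith
  have hcases := eq_zero_or_eq_one_of_sum_mul_eq_zero (A := range T ×ˢ range w)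
    (d := fun x => shortfall T b x.1 x.2)
    (fun x hx => h.shortfall_nonneg _ (mem_range.1 (mem_product.1 hx).1) _
      ((mem_range.1 (mem_product.1 hx).2).trans w.lt_succ_self))
    (fun x hx => h.shortfall_le_one _ (mem_range.1 (mem_product.1 hx).1) _
      (mem_range.1 (mem_product.1 hx).2))
    (by simpa [sum_product, total] using hprod)
  simp only [Prod.forall, mem_product, mem_range, and_imp] at hcases
  exact hcases.imp (fun h r hr k hk => h r k hr hk) fun h r hr k hk => h r k hr hk

end FullRows

section PartialLastRow

variable {m s T R G p u v w : ℕ} {b e : ℕ → ℕ → ℤ}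

theorem partial_last_row_estimate_of_add_le {T u w X P : ℤ} (hu : 1 ≤ u) (huw : u ≤ w)
    (hP0 : 0 ≤ P) (hXw : X ≤ w * T) (h : P + u ≤ T) :
    2 * X * (T - P - u) <
      2 * u * T * ((w + 1) * T - u + 1) - P * ((w + 1) * T + 2 * u * T - T - u - P) := by
  obtain ⟨v, rfl⟩ : ∃ v, u = v + 1 := ⟨u - 1, by ring⟩
  obtain ⟨q, rfl⟩ : ∃ q, w = v + 1 + q := ⟨w - (v + 1), by ring⟩
  obtain ⟨x, rfl⟩ : ∃ x, T = P + (v + 1) + x := ⟨T - (P + (v + 1)), by ring⟩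
  have hv : 0 ≤ v := by linarith
  have hq : 0 ≤ q := by linarith
  have hx : 0 ≤ x := by linarith
  have hX : 2 * X * (P + (v + 1) + x - P - (v + 1)) ≤
      2 * ((v + 1 + q) * (P + (v + 1) + x)) * x := by
    linarith [mul_le_mul_of_nonneg_right hXw hx]
  refine hX.trans_lt (sub_pos.1 ?_)
  ring_nf
  positivity

theorem partial_last_row_estimate_of_le_two_mul {R u w X P : ℤ} (hR : 0 ≤ R) (hu : 1 ≤ u)
    (huw : u ≤ w) (hX0 : 0 ≤ X) (h : R + 1 ≤ P + u) (hPR : P ≤ 2 * R) :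
    2 * X * (R + 1 - P - u) < 2 * u * (R + 1) * ((w + 1) * (R + 1) - u + 1) -
      P * ((w + 1) * (R + 1) + 2 * u * (R + 1) - (R + 1) - u - P) := by
  obtain ⟨v, rfl⟩ : ∃ v, u = v + 1 := ⟨u - 1, by ring⟩
  obtain ⟨q, rfl⟩ : ∃ q, w = v + 1 + q := ⟨w - (v + 1), by ring⟩
  obtain ⟨z, rfl⟩ : ∃ z, P = 2 * R - z := ⟨2 * R - P, by ring⟩
  have hv : 0 ≤ v := by linarith
  have hq : 0 ≤ q := by linarith
  have hz : 0 ≤ z := by linarith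
  have hX : 2 * X * (R + 1 - (2 * R - z) - (v + 1)) ≤ 0 :=
    mul_nonpos_of_nonneg_of_nonpos (by linarith) (by linarith)
  refine hX.trans_lt ?_
  have coeff_q : 0 ≤ q * (1 + R) * (2 + 2 * v + 2 * R * v + z) := by positivity
  have coeff_v : 0 ≤ v * (4 + 6 * R + 2 * z + 3 * (R * z)) := by positivity
  have coeff_v_sq : 0 ≤ v ^ 2 * (2 * R + 2 * R ^ 2) := by positivity
  have constant : 0 < 4 + 4 * R + 2 * z + 2 * R ^ 2 - R * z + z ^ 2 := by
    nlinarith [sq_nonneg (2 * z - R), sq_nonneg R]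
  linarith

theorem partial_last_row_estimate_of_two_mul_le {R u w X P : ℤ} (hR : 0 ≤ R) (hu : 1 ≤ u)
    (huw : u ≤ w) (hP : P ≤ 2 * u * R) (h : R + 1 ≤ P + u) (hPR : 2 * R ≤ P)
    (hXP : P - 2 * R ≤ 2 * X) :
    2 * X * (R + 1 - P - u) < 2 * u * (R + 1) * ((w + 1) * (R + 1) - u + 1) -
      P * ((w + 1) * (R + 1) + 2 * u * (R + 1) - (R + 1) - u - P) := by
  obtain ⟨v, rfl⟩ : ∃ v, u = v + 1 := ⟨u - 1, by ring⟩
  obtain ⟨q, rfl⟩ : ∃ q, w = v + 1 + q := ⟨w - (v + 1), by ring⟩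
  obtain ⟨x, rfl⟩ : ∃ x, P = 2 * R + x := ⟨P - 2 * R, by ring⟩
  have hv : 0 ≤ v := by linarith
  have hq : 0 ≤ q := by linarith
  have hx : 0 ≤ x := by linarith
  have hxv : x ≤ 2 * v * R := by linarith
  have hX : 2 * X * (R + 1 - (2 * R + x) - (v + 1)) ≤ x * (R + 1 - (2 * R + x) - (v + 1)) :=
    mul_le_mul_of_nonpos_right (by linarith) (by linarith)
  refine hX.trans_lt (sub_pos.1 ?_)
  have coeff_q : 0 ≤ q * (1 + R) * (2 + 2 * v + 2 * R * v - x) :=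
    mul_nonneg (by positivity) (by linarith)
  have coeff_v : 0 ≤ v * (2 * v * R - x) := mul_nonneg hv (by linarith)
  have quadratic : 0 ≤ 2 * x ^ 2 - 3 * R * x * v + 2 * R ^ 2 * v ^ 2 := by
    nlinarith [sq_nonneg (x - R * v), mul_nonneg hx (mul_nonneg hR hv)]
  have linear : 0 ≤ (2 * R - 2) * x + 2 * R ^ 2 := by
    rcases hR.eq_or_lt with rfl | hRpos
    · obtain rfl : x = 0 := by linarith
      simp
    · have hcoeff : 0 ≤ 2 * R - 2 := by linarith [Int.add_one_le_of_lt hRpos]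
      positivity
  nlinarith [mul_nonneg hR hv]

theorem partial_last_row_estimate {T u w X P : ℤ} (hT : 1 ≤ T) (hu : 1 ≤ u) (huw : u ≤ w)
    (hP0 : 0 ≤ P) (hP : P ≤ 2 * u * (T - 1)) (hX0 : 0 ≤ X) (hXw : X ≤ w * T)
    (hXP : P - 2 * (T - 1) ≤ 2 * X) :
    2 * X * (T - P - u) <
      2 * u * T * ((w + 1) * T - u + 1) - P * ((w + 1) * T + 2 * u * T - T - u - P) := by
  rcases le_total (P + u) T with h | h
  · exact partial_last_row_estimate_of_add_le hu huw hP0 hXw h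
  · obtain ⟨R, rfl⟩ : ∃ R, T = R + 1 := ⟨T - 1, by ring⟩
    rw [add_sub_cancel_right] at hP hXP
    rcases le_total P (2 * R) with hPR | hPR
    · exact partial_last_row_estimate_of_le_two_mul (by linarith) hu huw hX0 h hPR
    · exact partial_last_row_estimate_of_two_mul_le (by linarith) hu huw hP h hPR hXP

/-- The part of an array that exceeds level one; it and `lowPart` are estimated separately. -/
def highPart (e : ℕ → ℕ → ℤ) (r k : ℕ) : ℤ := max (e r k - 1) 0

/-- The part of an array up to level one, the complement of `highPart`. -/
def lowPart (e : ℕ → ℕ → ℤ) (r k : ℕ) : ℤ := e r k - highPart e r k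

theorem lowPart_eq_min (e : ℕ → ℕ → ℤ) (r k : ℕ) : lowPart e r k = min (e r k) 1 := by
  rw [lowPart, highPart]
  omega

theorem highPart_nonneg (e : ℕ → ℕ → ℤ) (r k : ℕ) : 0 ≤ highPart e r k := le_max_right _ _

theorem lowPart_nonneg {r k : ℕ} (h : 0 ≤ e r k) : 0 ≤ lowPart e r k := by
  rw [lowPart_eq_min]
  exact le_min h zero_le_one

theorem lowPart_le_one (e : ℕ → ℕ → ℤ) (r k : ℕ) : lowPart e r k ≤ 1 := by
  rw [lowPart_eq_min]
  exact min_le_right _ _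

theorem lowPart_eq_one {r k : ℕ} (h : 1 ≤ e r k) : lowPart e r k = 1 := by
  rw [lowPart_eq_min, min_eq_right h]

theorem highPart_le_two_mul_lowPart {r k : ℕ} (h0 : 0 ≤ e r k) (h3 : e r k ≤ 3) :
    highPart e r k ≤ 2 * lowPart e r k := by
  rw [lowPart, highPart]
  omega

theorem add_two_mul_highPart_le_sq (e : ℕ → ℕ → ℤ) (r k : ℕ) :
    e r k + 2 * highPart e r k ≤ e r k ^ 2 := by
  rw [highPart]
  rcases le_total (e r k - 1) 0 with h | h
  · rw [max_eq_right h]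
    linarith [zero_le_sq_sub_self (e r k)]
  · rw [max_eq_left h]
    nlinarith [zero_le_sq_sub_self (e r k - 1)]

theorem total_eq_of_left_zero (hleft : ∀ r < G + 1, ∀ k < p, e r k = 0)
    (hbottom : ∀ j < u, e G (p + j) = 1) :
    total (G + 1) (p + u) e = total G u (fun r j => e r (p + j)) + u := by
  have hrow (r) (hr : r ∈ range (G + 1)) :
      ∑ k ∈ range (p + u), e r k = ∑ j ∈ range u, e r (p + j) := by
    rw [sum_range_add, sum_eq_zero fun k hk => hleft r (mem_range.1 hr) k (mem_range.1 hk),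
      zero_add]
  rw [total, sum_congr rfl hrow, sum_range_succ,
    sum_congr rfl fun j hj => hbottom j (mem_range.1 hj)]
  simp [total]

theorem rowMoment_eq_of_left_zero (hleft : ∀ r < G + 1, ∀ k < p, e r k = 0)
    (hbottom : ∀ j < u, e G (p + j) = 1) :
    rowMoment (G + 1) (p + u) e = rowMoment G u (fun r j => e r (p + j)) +
      (G * u - total G u fun r j => e r (p + j)) := by
  have hrow (r) (hr : r < G + 1) : ∑ k ∈ range (p + u), e r k = ∑ j ∈ range u, e r (p + j) := by
    rw [sum_range_add, sum_eq_zero fun k hk => hleft r hr k (mem_range.1 hk), zero_add]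
  rw [rowMoment, moment_congr hrow, moment_succ, sum_sub_distrib,
    sum_congr rfl fun j hj => hbottom j (mem_range.1 hj)]
  simp [rowMoment, total]

theorem colMoment_eq_of_left_zero (hleft : ∀ r < G + 1, ∀ k < p, e r k = 0)
    (hbottom : ∀ j < u, e G (p + j) = 1) :
    colMoment (G + 1) (p + u) e = colMoment G u (fun r j => e r (p + j)) +
      p * (total G u (fun r j => e r (p + j)) + u) := by
  have hrow (r) (hr : r ∈ range (G + 1)) : moment (p + u) (e r) =
      moment u (fun j => e r (p + j)) + p * ∑ j ∈ range u, e r (p + j) := by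
    have hzero := fun k hk => hleft r (mem_range.1 hr) k hk
    rw [moment_add_range, moment_congr hzero, moment_const,
      sum_eq_zero fun k hk => hzero k (mem_range.1 hk)]
    ring
  have hbottomMoment : moment u (fun j => e G (p + j)) = 0 := by
    rw [moment_congr hbottom, moment_const]
  rw [colMoment, sum_congr rfl hrow, sum_add_distrib, ← mul_sum, sum_range_succ, hbottomMoment,
    sum_range_succ _ G, sum_congr rfl fun j hj => hbottom j (mem_range.1 hj)]
  simp [colMoment, total]

theorem total_eq_of_last_one (hlast : ∀ r < G, e r w = 1) :
    total G (w + 1) e = total G w e + G := by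
  rw [total_succ_right, sum_congr rfl fun r hr => hlast r (mem_range.1 hr)]
  simp

theorem rowMoment_eq_of_last_one (hlast : ∀ r < G, e r w = 1) :
    rowMoment G (w + 1) e = rowMoment G w e := by
  rw [rowMoment_succ_right, moment_congr hlast, moment_const, add_zero]

theorem colMoment_eq_of_last_one (hlast : ∀ r < G, e r w = 1) :
    colMoment G (w + 1) e = colMoment G w e + (w * G - total G w e) := by
  rw [colMoment_succ_right, sum_congr rfl fun r hr => hlast r (mem_range.1 hr)]
  simp

theorem total_highPart_le (hw : w = p + u) (h0 : ∀ r < G, ∀ k < w + 1, 0 ≤ e r k)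
    (h3 : ∀ r < G, ∀ k < w + 1, e r k ≤ 3) :
    (total G (u + 1) fun r j => highPart e r (p + j)) ≤
      2 * total G w (lowPart e) + 2 * G := by
  subst hw
  have hrow (r) (hr : r ∈ range G) : ∑ j ∈ range (u + 1), highPart e r (p + j) ≤
      2 * ∑ k ∈ range (p + u), lowPart e r k + 2 := by
    have hr := mem_range.1 hr
    have hlast : highPart e r (p + u) ≤ 2 :=
      (highPart_le_two_mul_lowPart (h0 r hr _ (by omega)) (h3 r hr _ (by omega))).trans
        (by linarith [lowPart_le_one e r (p + u)])
    have hinit : ∑ j ∈ range u, highPart e r (p + j) ≤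
        2 * ∑ j ∈ range u, lowPart e r (p + j) := by
      rw [mul_sum]
      refine sum_le_sum fun j hj => ?_
      have hj := mem_range.1 hj
      exact highPart_le_two_mul_lowPart (h0 r hr _ (by omega)) (h3 r hr _ (by omega))
    have hleft : 0 ≤ ∑ k ∈ range p, lowPart e r k :=
      sum_nonneg fun k hk => lowPart_nonneg (h0 r hr k (by have := mem_range.1 hk; omega))
    rw [sum_range_succ, sum_range_add]
    linarith
  refine (sum_le_sum hrow).trans_eq ?_
  rw [sum_add_distrib, ← mul_sum, total]
  simp [mul_comm]

theorem IsSizeArray.shortfall_bottom (h : IsSizeArray m s (R + 1) R p b) {k : ℕ} (hpk : p ≤ k)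
    (hk : k < m) : shortfall (R + 1) b R k = 2 := by
  rw [shortfall, h.zero_last k hpk hk]
  push_cast
  ring

theorem IsSizeArray.highPart_left (h : IsSizeArray m s (R + 1) R p b) (r : ℕ) (hr : r < R + 1)
    (k : ℕ) (hk : k < p) : highPart (shortfall (R + 1) b) r k = 0 := by
  have hle := h.shortfall_le (hk.trans h.p_lt) le_rfl (fun _ => hk) hr
  rw [sub_self] at hle
  exact max_eq_right (by linarith)

theorem IsSizeArray.highPart_bottom (h : IsSizeArray (p + u) s (R + 1) R p b) (j : ℕ)
    (hj : j < u) : highPart (shortfall (R + 1) b) R (p + j) = 1 := by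
  rw [highPart, h.shortfall_bottom (p.le_add_right j) (Nat.add_lt_add_left hj p)]
  norm_num

theorem IsSizeArray.lowPart_col (h : IsSizeArray m s (R + 1) R p b) (k : ℕ) (hk : k < m) :
    MonotoneOn (lowPart (shortfall (R + 1) b) · k) (Set.Iio (R + 1)) := by
  have mono {n : ℕ} (hn : n ≤ R + 1) (hp : n = R + 1 → k < p) :
      MonotoneOn (lowPart (shortfall (R + 1) b) · k) (Set.Iio n) := fun r hr r' hr' hrr => by
    simp only [lowPart_eq_min]
    exact min_le_min_right 1 (h.monotoneOn_shortfall_col hk hn hp hr hr' hrr)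
  rcases Nat.lt_or_ge k p with hkp | hkp
  · exact mono le_rfl fun _ => hkp
  · intro r hr r' hr' hrr
    rcases (Nat.lt_succ_iff.1 hr').lt_or_eq with hR | rfl
    · exact mono R.le_succ (by omega) (hrr.trans_lt hR) hR hrr
    · exact (lowPart_le_one _ r k).trans_eq
        (lowPart_eq_one (by rw [h.shortfall_bottom hkp hk]; norm_num)).symm

theorem IsSizeArray.lowPart_row (h : IsSizeArray (w + 1) s T R p b) (r : ℕ) :
    MonotoneOn (lowPart (shortfall T b) r) (Set.Iio w) := by
  intro k hk l hl hkl
  simp only [lowPart_eq_min]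
  exact min_le_min_right 1 (h.monotoneOn_shortfall_row r (hk.trans w.lt_succ_self)
    (hl.trans w.lt_succ_self) hkl)

theorem IsSizeArray.rowMoment_highPart_nonneg (h : IsSizeArray (p + u) s T R p b) :
    0 ≤ rowMoment R u fun r j => highPart (shortfall T b) r (p + j) :=
  rowMoment_nonneg fun _ hj _ hr _ hr' hrr => max_le_max_right 0 (sub_le_sub_right
    (h.monotoneOn_shortfall_col (Nat.add_lt_add_left hj p) R.le_succ (by omega) hr hr' hrr) 1)

theorem IsSizeArray.colMoment_highPart_nonneg (h : IsSizeArray (p + u) s T R p b) :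
    0 ≤ colMoment R u fun r j => highPart (shortfall T b) r (p + j) :=
  colMoment_nonneg fun r _ _ hj _ hl hjl => max_le_max_right 0 (sub_le_sub_right
    (h.monotoneOn_shortfall_row r (Nat.add_lt_add_left hj p) (Nat.add_lt_add_left hl p)
      (Nat.add_le_add_left hjl p)) 1)

theorem IsSizeArray.lowPart_last (h : IsSizeArray (w + 1) (2 * T + 1) T R p b) (r : ℕ)
    (hr : r < T) : lowPart (shortfall T b) r w = 1 :=
  lowPart_eq_one (h.one_le_shortfall_last hr)

theorem IsSizeArray.total_shortfall
    (h : IsSizeArray (p + v + 1) (2 * (R + 1) + 1) (R + 1) R p b) :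
    total (R + 1) (p + v + 1) (shortfall (R + 1) b) =
      total (R + 1) (p + v) (lowPart (shortfall (R + 1) b)) + (R + 1) +
        (total R (v + 1) (fun r j => highPart (shortfall (R + 1) b) r (p + j)) + (v + 1)) := by
  have hlow := total_eq_of_last_one h.lowPart_last
  have hhigh := total_eq_of_left_zero h.highPart_left
    (IsSizeArray.highPart_bottom (u := v + 1) h)
  have hsub :=
    total_sub (R + 1) (p + v + 1) (shortfall (R + 1) b) (highPart (shortfall (R + 1) b))
  change total _ _ (lowPart _) = _ at hsub
  rw [← add_assoc] at hhigh
  push_cast at *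
  linarith

theorem IsSizeArray.rowMoment_shortfall
    (h : IsSizeArray (p + v + 1) (2 * (R + 1) + 1) (R + 1) R p b) :
    rowMoment (R + 1) (p + v + 1) (shortfall (R + 1) b) =
      rowMoment (R + 1) (p + v) (lowPart (shortfall (R + 1) b)) +
        (rowMoment R (v + 1) (fun r j => highPart (shortfall (R + 1) b) r (p + j)) +
          (R * (v + 1) - total R (v + 1) fun r j => highPart (shortfall (R + 1) b) r (p + j))) := by
  have hlow := rowMoment_eq_of_last_one h.lowPart_last
  have hhigh := rowMoment_eq_of_left_zero h.highPart_left
    (IsSizeArray.highPart_bottom (u := v + 1) h)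
  have hsub :=
    rowMoment_sub (R + 1) (p + v + 1) (shortfall (R + 1) b) (highPart (shortfall (R + 1) b))
  change rowMoment _ _ (lowPart _) = _ at hsub
  rw [← add_assoc] at hhigh
  push_cast at *
  linarith

theorem IsSizeArray.colMoment_shortfall
    (h : IsSizeArray (p + v + 1) (2 * (R + 1) + 1) (R + 1) R p b) :
    colMoment (R + 1) (p + v + 1) (shortfall (R + 1) b) =
      colMoment (R + 1) (p + v) (lowPart (shortfall (R + 1) b)) +
        ((p + v) * (R + 1) - total (R + 1) (p + v) (lowPart (shortfall (R + 1) b))) +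
        (colMoment R (v + 1) (fun r j => highPart (shortfall (R + 1) b) r (p + j)) + p *
          (total R (v + 1) (fun r j => highPart (shortfall (R + 1) b) r (p + j)) + (v + 1))) := by
  have hlow := colMoment_eq_of_last_one h.lowPart_last
  have hhigh := colMoment_eq_of_left_zero h.highPart_left
    (IsSizeArray.highPart_bottom (u := v + 1) h)
  have hsub :=
    colMoment_sub (R + 1) (p + v + 1) (shortfall (R + 1) b) (highPart (shortfall (R + 1) b))
  change colMoment _ _ (lowPart _) = _ at hsub
  rw [← add_assoc] at hhigh
  push_cast at *
  linarith

theorem total_add_two_mul_total_highPart_le (G w : ℕ) (e : ℕ → ℕ → ℤ) :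
    total G w e + 2 * total G w (highPart e) ≤ total G w fun r k => e r k ^ 2 := by
  simp only [total, mul_sum, ← sum_add_distrib]
  exact sum_le_sum fun r _ => sum_le_sum fun k _ => add_two_mul_highPart_le_sq e r k

theorem IsSizeArray.sum_shortfall_last_le (h : IsSizeArray (w + 1) (2 * T + 1) T R p b) :
    ∑ r ∈ range T, shortfall T b r w ≤ T + total T (w + 1) (highPart (shortfall T b)) := by
  have hsplit (r) (hr : r ∈ range T) :
      shortfall T b r w ≤ 1 + ∑ k ∈ range (w + 1), highPart (shortfall T b) r k := by
    have hlow := h.lowPart_last r (mem_range.1 hr)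
    have hhigh := single_le_sum (f := highPart (shortfall T b) r)
      (fun k _ => highPart_nonneg _ r k) (self_mem_range_succ w)
    rw [lowPart] at hlow
    linarith
  refine (sum_le_sum hsplit).trans_eq ?_
  rw [sum_add_distrib]
  simp [total]

theorem total_le_mul {c : ℤ} (h : ∀ r < G, ∀ k < w, e r k ≤ c) : total G w e ≤ G * w * c := by
  rw [← total_const]
  exact sum_le_sum fun r hr => sum_le_sum fun k hk => h r (mem_range.1 hr) k (mem_range.1 hk)

theorem IsSizeArray.shortfall_le_three (h : IsSizeArray m s (R + 1) R p b) (r : ℕ) (hr : r < R)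
    (k : ℕ) (hk : k < m) : shortfall (R + 1) b r k ≤ 3 := by
  have hle := h.shortfall_le hk R.le_succ (by omega) hr
  push_cast at hle
  linarith

theorem IsSizeArray.lowPart_highPart_estimate
    (h : IsSizeArray (p + v + 1) (2 * (R + 1) + 1) (R + 1) R p b) (hp : 0 < p)
    {X P : ℤ}
    (hX : X = total (R + 1) (p + v) (lowPart (shortfall (R + 1) b)))
    (hP : P = total R (v + 1) fun r j => highPart (shortfall (R + 1) b) r (p + j)) :
    2 * X * (R + 1 - P - (v + 1)) < 2 * (v + 1) * (R + 1) * ((p + v + 1) * (R + 1) - (v + 1) + 1) -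
      P * ((p + v + 1) * (R + 1) + 2 * (v + 1) * (R + 1) - (R + 1) - (v + 1) - P) := by
  have hlow (r) (hr : r < R + 1) (k) (hk : k < p + v) := lowPart_nonneg
    (h.shortfall_nonneg r hr k (hk.trans (p + v).lt_succ_self))
  have hhigh_le : P ≤ 2 * (v + 1) * R := by
    have := total_le_mul (G := R) (w := v + 1)
      (e := fun r j => highPart (shortfall (R + 1) b) r (p + j)) (c := 2) fun r hr j hj =>
        max_le (by linarith [h.shortfall_le_three r hr (p + j) (by omega)]) (by norm_num)
    push_cast at this
    linarith
  have hhigh_le_low : P ≤ 2 * X + 2 * R := by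
    have hle := total_highPart_le (w := p + v) rfl
      (fun r (hr : r < R) => h.shortfall_nonneg r (hr.trans R.lt_succ_self)) h.shortfall_le_three
    have hlast := sum_nonneg fun k hk => hlow R R.lt_succ_self k (mem_range.1 hk)
    have hsucc : X = total R (p + v) (lowPart (shortfall (R + 1) b)) +
        ∑ k ∈ range (p + v), lowPart (shortfall (R + 1) b) R k := by
      rw [hX, total, sum_range_succ, total]
    linarith
  have hX_le := total_le_mul (G := R + 1) (w := p + v) fun r _ k _ =>
    lowPart_le_one (shortfall (R + 1) b) r k
  push_cast at hX_le
  exact partial_last_row_estimate (T := R + 1) (u := v + 1) (w := p + v)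
    (by linarith [Int.natCast_nonneg R]) (by linarith [Int.natCast_nonneg v])
    (by have := Nat.one_le_cast (α := ℤ).2 hp; linarith)
    (hP ▸ sum_nonneg fun r _ => sum_nonneg fun j _ => highPart_nonneg _ r (p + j)) (by linarith)
    (hX ▸ sum_nonneg fun r hr => sum_nonneg fun k hk =>
      hlow r (mem_range.1 hr) k (mem_range.1 hk)) (by linarith) (by linarith)

theorem IsSizeArray.lt_oddMax_of_last_row
    (h : IsSizeArray (p + v + 1) (2 * (R + 1) + 1) (R + 1) R p b) (hp : 0 < p) :
    3 * arrayGain (p + v + 1) (2 * (R + 1) + 1) (R + 1) b < oddMax (p + v + 1) (R + 1) := by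
  have hb : b = fun r k => 2 * ((R + 1 : ℕ) : ℤ) - 2 * r - shortfall (R + 1) b r k := by
    funext r k
    rw [shortfall]
    ring
  have hsq := total_add_two_mul_total_highPart_le (R + 1) (p + v + 1) (shortfall (R + 1) b)
  have hlast := h.sum_shortfall_last_le
  have hhigh := total_eq_of_left_zero h.highPart_left
    (IsSizeArray.highPart_bottom (u := v + 1) h)
  have hiso := total_mul_sub_total_le (G := R + 1) (w := p + v)
    (fun r hr k hk => lowPart_nonneg
      (h.shortfall_nonneg r hr k (hk.trans (p + v).lt_succ_self)))
    (fun r _ k _ => lowPart_le_one (shortfall (R + 1) b) r k) (fun r _ => h.lowPart_row r)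
    fun k hk => h.lowPart_col k (hk.trans (p + v).lt_succ_self)
  have hlowRow := rowMoment_nonneg fun k (hk : k < p + v) =>
    h.lowPart_col k (hk.trans (p + v).lt_succ_self)
  have hlowCol := colMoment_nonneg fun r (_ : r < R + 1) => h.lowPart_row r
  have hhighRow := IsSizeArray.rowMoment_highPart_nonneg (u := v + 1) h
  have hhighCol := IsSizeArray.colMoment_highPart_nonneg (u := v + 1) h
  have hest := h.lowPart_highPart_estimate hp rfl rfl
  have key := three_mul_arrayGain_odd (p + v + 1) (R + 1) (shortfall (R + 1) b)
  rw [← hb, Nat.add_sub_cancel, h.rowMoment_shortfall, h.colMoment_shortfall] at key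
  rw [h.total_shortfall] at hsq key
  rw [← add_assoc] at hhigh
  generalize total (R + 1) (p + v) (lowPart (shortfall (R + 1) b)) = X at *
  generalize total R (v + 1) (fun r j => highPart (shortfall (R + 1) b) r (p + j)) = P at *
  have hlowRow' := mul_nonneg (by positivity : (0 : ℤ) ≤ 2 * (p + v) * (R + 1) + 2 * R + 4) hlowRow
  have hlowCol' := mul_nonneg (by positivity : (0 : ℤ) ≤ R + 2) hlowCol
  have hhighRow' :=
    mul_nonneg (by positivity : (0 : ℤ) ≤ (p + v + 1) * (2 * (R + 1) + 1) + 1) hhighRow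
  have hhighCol' := mul_nonneg (by positivity : (0 : ℤ) ≤ 2 * (R + 1) + 1) hhighCol
  push_cast at *
  linarith

end PartialLastRow

section Residues

/-- The residues modulo `s` of the elements of `S` in `[qs, (q+1)s)`. -/
def res (s : ℕ) (S : Finset ℕ) (q : ℕ) : Finset ℕ :=
  (range s).filter fun ρ => q * s + ρ ∈ S

variable {m s : ℕ} {S : Finset ℕ}

theorem mem_res {q ρ : ℕ} : ρ ∈ res s S q ↔ ρ < s ∧ q * s + ρ ∈ S := by
  simp [res]

theorem block_succ_eq (q : ℕ) :
    block s S (q + 1) = (res s S q).map (addLeftEmbedding (q * s)) := by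
  ext x
  simp only [block, mem_filter, mem_map, mem_res, addLeftEmbedding_apply, Nat.add_sub_cancel,
    add_mul, one_mul]
  constructor
  · rintro ⟨hx, hlow, hhigh⟩
    exact ⟨x - q * s, ⟨by omega, by rwa [Nat.add_sub_cancel' hlow]⟩, Nat.add_sub_cancel' hlow⟩
  · rintro ⟨ρ, ⟨hρ, hmem⟩, rfl⟩
    exact ⟨hmem, by omega, by omega⟩

theorem a_succ (q : ℕ) : a s S (q + 1) = (res s S q).card := by
  rw [a, block_succ_eq, card_map]

theorem n_succ (q : ℕ) : n s S (q + 1) = (res s S q).sup id := by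
  rw [n, block_succ_eq, sup_map]
  refine sup_congr rfl fun ρ hρ => ?_
  simp [Nat.mod_eq_of_lt (mem_res.1 hρ).1]

theorem mem_iff_mod_mem_res (hs : 0 < s) {x : ℕ} : x ∈ S ↔ x % s ∈ res s S (x / s) := by
  rw [mem_res, Nat.div_add_mod', and_iff_right (Nat.mod_lt _ hs)]

theorem ext_of_res (hs : 0 < s) {S' : Finset ℕ} (h : ∀ q, res s S q = res s S' q) : S = S' := by
  ext x
  rw [mem_iff_mod_mem_res hs (S := S), h, ← mem_iff_mod_mem_res hs]

theorem sum_eq_sum_res (hs : 0 < s) {Q : ℕ} (hS : ∀ x ∈ S, x < Q * s) (g : ℕ → ℤ) :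
    ∑ x ∈ S, g x = ∑ q ∈ range Q, ∑ ρ ∈ res s S q, g (q * s + ρ) := by
  have hdiv : ∀ x ∈ S, x / s ∈ range Q := fun x hx => by
    rw [mem_range, Nat.div_lt_iff_lt_mul hs]
    exact hS x hx
  rw [← sum_fiberwise_of_maps_to hdiv]
  refine sum_congr rfl fun q _ => ?_
  have hfiber : S.filter (fun x => x / s = q) = (res s S q).map (addLeftEmbedding (q * s)) := by
    rw [← block_succ_eq, block]
    refine filter_congr fun x _ => ?_
    rw [Nat.add_sub_cancel, Nat.div_eq_iff hs, add_mul, one_mul]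
    omega
  rw [hfiber, sum_map]
  rfl

theorem sum_range_mul_eq (T m : ℕ) (f : ℕ → ℤ) :
    ∑ q ∈ range (T * m), f q = ∑ r ∈ range T, ∑ k ∈ range m, f (r * m + k) := by
  induction T with
  | zero => simp
  | succ T ih => rw [add_mul, one_mul, sum_range_add, ih, sum_range_succ]

/-- The number of elements in the block in row `r` and column `k`. -/
def cnt (m s : ℕ) (S : Finset ℕ) (r k : ℕ) : ℤ := (res s S (r * m + k)).card

/-- The indicator function of the last column, where the pyramids leave room for one residue
less. -/
def lastInd (m k : ℕ) : ℕ := if k + 1 = m then 1 else 0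

theorem lastInd_of_lt {k : ℕ} (h : k + 1 < m) : lastInd m k = 0 := if_neg h.ne

theorem lastInd_of_eq {k : ℕ} (h : k + 1 = m) : lastInd m k = 1 := if_pos h

/-- One more than the largest admissible residue in row `r` and column `k`. -/
def top (m s r k : ℕ) : ℕ := s - r - lastInd m k

theorem top_of_lt {r k : ℕ} (h : k + 1 < m) : top m s r k = s - r := by
  rw [top, lastInd_of_lt h, Nat.sub_zero]

theorem top_last {r k : ℕ} (h : k + 1 = m) : top m s r k = s - r - 1 := by
  rw [top, lastInd_of_eq h]

theorem mul_add_mem_pyramid {N A B r j : ℕ} (hj : j < N) :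
    N * r + j ∈ pyramid N A B ↔ A + r ≤ j ∧ j + r ≤ B := by
  refine ⟨?_, fun h => ⟨r, j, hj, h.1, h.2, rfl⟩⟩
  rintro ⟨i, j', hj', hA, hB, h⟩
  have hN : 0 < N := (Nat.zero_le j).trans_lt hj
  have hdiv := congrArg (· / N) h
  have hmod := congrArg (· % N) h
  simp only [Nat.mul_add_div hN, Nat.div_eq_of_lt hj, Nat.div_eq_of_lt hj', add_zero] at hdiv
  simp only [Nat.mul_add_mod, Nat.mod_eq_of_lt hj, Nat.mod_eq_of_lt hj'] at hmod
  subst hdiv hmod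
  exact ⟨hA, hB⟩

theorem mul_add_mem_pyramid_column {r k ρ c δ : ℕ} (hk : k < m) (hρ : ρ < s) (hδ : δ < s) :
    (r * m + k) * s + ρ ∈ pyramid (m * s) (c * s + 1) ((c + 1) * s - 1 - δ) ↔
      c = k ∧ r + 1 ≤ ρ ∧ ρ < s - r - δ := by
  have hj : k * s + ρ < m * s := by
    have := Nat.mul_le_mul_right s (Nat.succ_le_of_lt hk)
    rw [Nat.succ_mul] at this
    omega
  rw [show (r * m + k) * s + ρ = m * s * r + (k * s + ρ) by ring, mul_add_mem_pyramid hj,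
    add_mul, one_mul]
  constructor
  · rintro ⟨hlow, hhigh⟩
    obtain rfl : c = k := by
      rcases lt_trichotomy c k with hck | hck | hck
      · have := Nat.mul_le_mul_right s (Nat.succ_le_of_lt hck)
        rw [Nat.succ_mul] at this
        omega
      · exact hck
      · have := Nat.mul_le_mul_right s (Nat.succ_le_of_lt hck)
        rw [Nat.succ_mul] at this
        omega
    omega
  · rintro ⟨rfl, hlow, hhigh⟩
    omega

theorem mul_add_mem_bigL (hm : 2 ≤ m) (hs : 2 ≤ s) {r k ρ : ℕ} (hk : k < m) (hρ : ρ < s) :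
    (r * m + k) * s + ρ ∈ bigL m s ↔ r + 1 ≤ ρ ∧ ρ < top m s r k := by
  have column (c : ℕ) := mul_add_mem_pyramid_column (r := r) (c := c) (δ := 0) hk hρ (by omega)
  have last := mul_add_mem_pyramid_column (r := r) (c := m - 1) hk hρ hs
  rw [show (m - 1 + 1) * s - 1 - 1 = m * s - 2 by rw [Nat.sub_add_cancel (by omega)]; omega] at last
  simp only [Nat.sub_zero] at column
  rw [bigL, Set.mem_union, last]
  constructor
  · rintro (⟨c, hc, hcm, hmem⟩ | ⟨hkm, hlow, hhigh⟩)
    · obtain ⟨c, rfl⟩ := Nat.exists_eq_add_of_le' hc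
      obtain ⟨rfl, hlow, hhigh⟩ := (column c).1 hmem
      exact ⟨hlow, by rwa [top_of_lt (by omega)]⟩
    · exact ⟨hlow, by rwa [top_last (by omega)]⟩
  · rintro ⟨hlow, hhigh⟩
    rcases Nat.lt_or_ge (k + 1) m with hkm | hkm
    · rw [top_of_lt hkm] at hhigh
      exact Or.inl ⟨k + 1, by omega, by omega, (column k).2 ⟨rfl, hlow, hhigh⟩⟩
    · rw [top_last (by omega)] at hhigh
      exact Or.inr ⟨by omega, hlow, hhigh⟩

theorem res_subset (hm : 2 ≤ m) (hs : 2 ≤ s) (hS : (S : Set ℕ) ⊆ bigL m s) {r k : ℕ}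
    (hk : k < m) : res s S (r * m + k) ⊆ Ico (r + 1) (top m s r k) := fun ρ hρ => by
  have h := mem_res.1 hρ
  rw [mem_Ico]
  exact (mul_add_mem_bigL hm hs hk h.1).1 (hS h.2)

theorem top_le (m s r k : ℕ) : top m s r k ≤ s - r := Nat.sub_le _ _

theorem lt_of_mem (hm : 2 ≤ m) (hs : 2 ≤ s) (hS : (S : Set ℕ) ⊆ bigL m s) {x : ℕ} (hx : x ∈ S) :
    x < s / 2 * m * s := by
  have hres : x % s ∈ res s S (x / s / m * m + x / s % m) := by
    rwa [Nat.div_add_mod', ← mem_iff_mod_mem_res (by omega)]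
  have hmem := mem_Ico.1 (res_subset hm hs hS (Nat.mod_lt _ (by omega)) hres)
  have htop := top_le m s (x / s / m) (x / s % m)
  have hrow : x / s / m < s / 2 := by omega
  rwa [Nat.div_lt_iff_lt_mul (by omega), Nat.div_lt_iff_lt_mul (by omega)] at hrow

end Residues

section Size

/-- Twice the size function, as an integer. -/
def twiceSize (S : Finset ℕ) : ℤ := 2 * ∑ x ∈ S, (x : ℤ) - (S.card : ℤ) ^ 2 + S.card

theorem two_mul_sizeCount (S : Finset ℕ) : 2 * sizeCount S = twiceSize S := by
  rw [sizeCount, twiceSize]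
  push_cast
  ring

/-- Twice the loss in the sum of a set `B` compared with the `|B|` largest numbers below `H`. -/
def defect (B : Finset ℕ) (H : ℕ) : ℤ :=
  2 * B.card * H - (B.card : ℤ) ^ 2 - B.card - 2 * ∑ x ∈ B, (x : ℤ)

variable {B : Finset ℕ} {H : ℕ}

theorem defect_add (B : Finset ℕ) (H j : ℕ) : defect B (H + j) = defect B H + 2 * j * B.card := by
  rw [defect, defect]
  push_cast
  ring

theorem defect_succ_of_mem (hH : H ∈ B) : defect B (H + 1) = defect (B.erase H) H := by
  rw [defect, defect, ← card_erase_add_one hH, ← add_sum_erase B (fun x => (x : ℤ)) hH]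
  push_cast
  ring

theorem lt_of_mem_erase_of_lt_succ (hB : ∀ x ∈ B, x < H + 1) : ∀ x ∈ B.erase H, x < H :=
  fun x hx => (Nat.lt_succ_iff.1 (hB x (mem_of_mem_erase hx))).lt_of_ne (ne_of_mem_erase hx)

theorem defect_nonneg (hB : ∀ x ∈ B, x < H) : 0 ≤ defect B H := by
  induction H generalizing B with
  | zero => simp [eq_empty_of_forall_notMem fun x hx => Nat.not_lt_zero x (hB x hx), defect]
  | succ H ih =>
    have herase := ih (lt_of_mem_erase_of_lt_succ hB)
    by_cases hH : H ∈ B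
    · rwa [defect_succ_of_mem hH]
    · rw [erase_eq_of_notMem hH] at herase
      rw [defect_add]
      positivity

theorem eq_Ico_of_defect_eq_zero (hB : ∀ x ∈ B, x < H) (h : defect B H = 0) :
    B = Ico (H - B.card) H := by
  induction H generalizing B with
  | zero => simp [eq_empty_of_forall_notMem fun x hx => Nat.not_lt_zero x (hB x hx)]
  | succ H ih =>
    have hlt := lt_of_mem_erase_of_lt_succ hB
    by_cases hH : H ∈ B
    · rw [defect_succ_of_mem hH] at h
      have herase := ih hlt h
      have hcard : (B.erase H).card ≤ H := by
        simpa using card_le_card (fun x hx => mem_range.2 (hlt x hx) : B.erase H ⊆ range H)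
      rw [← insert_erase hH, card_insert_of_notMem (notMem_erase H B), Nat.add_sub_add_right]
      conv_lhs => rw [herase]
      rw [insert_Ico_right_eq_Ico_add_one (by omega)]
    · rw [erase_eq_of_notMem hH] at hlt
      have hcard : (B.card : ℤ) = 0 := by
        have hnonneg := defect_nonneg hlt
        rw [defect_add] at h
        push_cast at h
        linarith [Nat.cast_nonneg (α := ℤ) B.card]
      rw [Nat.cast_eq_zero, card_eq_zero] at hcard
      simp [hcard]

theorem defect_Ico {l H : ℕ} : defect (Ico l H) H = 0 := by
  induction H with
  | zero => simp [defect]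
  | succ H ih =>
    rcases Nat.lt_or_ge H l with hlt | hle
    · rw [Ico_eq_empty (by omega)]
      simp [defect]
    · have herase : (Ico l (H + 1)).erase H = Ico l H := by
        rw [← insert_Ico_right_eq_Ico_add_one hle, erase_insert (by simp)]
      rw [defect_succ_of_mem (by simp [hle]), herase, ih]

variable {m s : ℕ} {S : Finset ℕ}

theorem defect_res (r k H : ℕ) :
    defect (res s S (r * m + k)) H = blockGain m s r k (cnt m s S r k)
      - 2 * ((s - r - H) * cnt m s S r k)
      - 2 * ∑ ρ ∈ res s S (r * m + k), (((r * m + k) * s + ρ : ℕ) : ℤ) := by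
  rw [defect, blockGain, cnt]
  push_cast
  rw [sum_add_distrib, sum_const, nsmul_eq_mul]
  ring

theorem sum_defect_res_top (hm : 0 < m) {r : ℕ} (hr : r < s) :
    ∑ k ∈ range m, defect (res s S (r * m + k)) (top m s r k) =
      ∑ k ∈ range m, blockGain m s r k (cnt m s S r k) - 2 * cnt m s S r (m - 1)
        - 2 * ∑ k ∈ range m, ∑ ρ ∈ res s S (r * m + k), (((r * m + k) * s + ρ : ℕ) : ℤ) := by
  have htop : ∀ k ∈ range m, ((s : ℤ) - r - top m s r k) * cnt m s S r k =
      if k = m - 1 then cnt m s S r k else 0 := fun k _ => by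
    have hcast : ((s : ℤ) - r - top m s r k) = if k = m - 1 then 1 else 0 := by
      rw [top, lastInd]
      split_ifs <;> omega
    rw [hcast, ite_mul, one_mul, zero_mul]
  simp only [defect_res, sum_sub_distrib, ← mul_sum]
  rw [sum_congr rfl htop, sum_ite_eq', if_pos (mem_range.2 (by omega))]

theorem twiceSize_eq (hm : 2 ≤ m) (hs : 2 ≤ s) (hS : (S : Set ℕ) ⊆ bigL m s) :
    twiceSize S = arrayGain m s (s / 2) (cnt m s S) -
      ∑ r ∈ range (s / 2), ∑ k ∈ range m, defect (res s S (r * m + k)) (top m s r k) := by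
  have hlt : ∀ x ∈ S, x < s / 2 * m * s := fun x hx => lt_of_mem hm hs hS hx
  have hsum := sum_eq_sum_res (by omega) hlt fun x => (x : ℤ)
  have hcard := sum_eq_sum_res (by omega) hlt fun _ => (1 : ℤ)
  rw [sum_range_mul_eq] at hsum hcard
  have htotal : (S.card : ℤ) = total (s / 2) m (cnt m s S) := by
    simpa [total, cnt] using hcard
  rw [sum_congr rfl fun r hr => sum_defect_res_top (by omega) (by have := mem_range.1 hr; omega)]
  rw [twiceSize, hsum, htotal, arrayGain, sum_sub_distrib, sum_sub_distrib, ← mul_sum, ← mul_sum]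
  ring

end Size

section BlockSizes

variable {m s : ℕ} {S : Finset ℕ}

theorem ceil_half (hs : 2 ≤ s) : ⌈((s : ℚ) - 1) / 2⌉₊ = s / 2 := by
  have hle : 2 * ((s / 2 : ℕ) : ℚ) ≤ s := by exact_mod_cast Nat.mul_div_le s 2
  have hlt : (s : ℚ) ≤ 2 * ((s / 2 : ℕ) : ℚ) + 1 := by
    exact_mod_cast (show s ≤ 2 * (s / 2) + 1 by omega)
  rw [Nat.ceil_eq_iff (by omega), Nat.cast_sub (show 1 ≤ s / 2 by omega), Nat.cast_one]
  constructor <;> linarith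

theorem numRows_spec (hm : 0 < m) (hs : 0 < s) (S : Finset ℕ) :
    1 ≤ numRows m s S ∧ ∀ x ∈ S, x < numRows m s S * (m * s) := by
  refine Nat.sInf_mem (s := {i : ℕ | 1 ≤ i ∧ ∀ x ∈ S, x < i * (m * s)})
    ⟨S.sup id + 1, by omega, fun x hx => ?_⟩
  have hle : x ≤ S.sup id := le_sup (f := id) hx
  have hpos : 0 < m * s := by positivity
  nlinarith

theorem lt_numRows (hm : 0 < m) (hs : 0 < s) {r k : ℕ}
    (h : (res s S (r * m + k)).Nonempty) : r < numRows m s S := by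
  obtain ⟨ρ, hρ⟩ := h
  have hlt := (numRows_spec hm hs S).2 _ (mem_res.1 hρ).2
  rw [← mul_assoc] at hlt
  by_contra! hle
  have := Nat.mul_le_mul_right s (Nat.le_add_right_of_le (k := k) (Nat.mul_le_mul_right m hle))
  omega

theorem add_one_lt_numRows_mul (hm : 0 < m) (hs : 0 < s) {r k : ℕ} (hk : k + 1 < m)
    (h : (res s S (r * m + (k + 1))).Nonempty) : r * m + k + 1 < numRows m s S * m := by
  have := Nat.mul_le_mul_right m (Nat.succ_le_of_lt (lt_numRows hm hs h))
  rw [Nat.succ_mul] at this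
  omega

theorem not_dvd_mul_add_add_one {r k : ℕ} (hk : k + 1 < m) : ¬ m ∣ r * m + k + 1 := by
  rw [add_assoc, Nat.dvd_add_right (Dvd.intro_left r rfl)]
  exact Nat.not_dvd_of_pos_of_lt (Nat.succ_pos k) hk

theorem cnt_le (hm : 2 ≤ m) (hs : 2 ≤ s) (hS : (S : Set ℕ) ⊆ bigL m s) {r k : ℕ}
    (hk : k < m) : cnt m s S r k ≤ ((top m s r k - (r + 1) : ℕ) : ℤ) := by
  rw [cnt, Nat.cast_le, ← Nat.card_Ico]
  exact card_le_card (res_subset hm hs hS hk)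

theorem res_eq_empty_of_le (hm : 2 ≤ m) (hs : 2 ≤ s) (hS : (S : Set ℕ) ⊆ bigL m s) {q : ℕ}
    (hq : s / 2 * m ≤ q) : res s S q = ∅ := by
  refine eq_empty_of_forall_notMem fun ρ hρ => ?_
  have hlt := lt_of_mem hm hs hS (mem_res.1 hρ).2
  have hle := Nat.mul_le_mul_right s hq
  omega

namespace IsGenBetaSet

variable (h : IsGenBetaSet m s S) (hm : 2 ≤ m) (hs : 2 ≤ s)
include h hm hs

theorem cnt_row (r : ℕ) {k : ℕ} (hk : k + 1 < m) : cnt m s S r (k + 1) ≤ cnt m s S r k := by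
  rw [cnt, cnt, Nat.cast_le]
  rcases (res s S (r * m + (k + 1))).eq_empty_or_nonempty with hempty | hnonempty
  · simp [hempty]
  · have hlt := add_one_lt_numRows_mul (by omega) (by omega) hk hnonempty
    have hcond := h.cond2 (r * m + k + 1) (by omega) hlt (not_dvd_mul_add_add_one hk)
    rwa [a_succ, a_succ] at hcond

theorem antitoneOn_cnt (r : ℕ) : AntitoneOn (cnt m s S r) (Set.Iio m) :=
  antitoneOn_of_add_one_le Set.ordConnected_Iio fun _ _ _ hk => h.cnt_row hm hs r hk

theorem cnt_col (r k : ℕ) (hk : k < m) (hpos : 0 < cnt m s S (r + 1) k) :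
    cnt m s S (r + 1) k + 2 ≤ cnt m s S r k := by
  rw [cnt, Int.natCast_pos] at hpos
  have hrow := lt_numRows (by omega) (by omega) (card_pos.1 hpos)
  have hle : (r + 1) * m ≤ (numRows m s S - 1) * m := Nat.mul_le_mul_right m (by omega)
  have hindex : r * m + k + 1 + m = (r + 1) * m + k + 1 := by ring
  rw [add_mul, one_mul] at hle
  have hcond := h.cond3 (r * m + k + 1) (by omega) (by omega)
  rw [hindex, a_succ, a_succ] at hcond
  rw [cnt, cnt]
  exact_mod_cast hcond hpos

theorem res_eq_empty_of_res_eq_empty {N q : ℕ} (hN : res s S N = ∅) (hq : N ≤ q) :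
    res s S q = ∅ := by
  induction q, hq using Nat.le_induction with
  | base => exact hN
  | succ q _ ih =>
    rcases Nat.lt_or_ge (q + 1) (s / 2 * m) with hlt | hge
    · have hcond := h.cond1 (q + 1) (by omega) (by rwa [ceil_half hs])
      rw [a_succ, a_succ, card_eq_zero, card_eq_zero] at hcond
      exact hcond ih
    · exact res_eq_empty_of_le hm hs h.subset hge

theorem exists_res_nonempty_iff :
    ∃ N, 0 < N ∧ N ≤ s / 2 * m ∧ ∀ q, (res s S q).Nonempty ↔ q < N := by
  have hempty := res_eq_empty_of_le hm hs h.subset le_rfl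
  classical
  have hex : ∃ q, res s S q = ∅ := ⟨_, hempty⟩
  have hiff : ∀ q, (res s S q).Nonempty ↔ q < Nat.find hex := fun q => by
    refine ⟨fun hq => ?_, fun hq => nonempty_iff_ne_empty.2 (Nat.find_min hex hq)⟩
    by_contra! hle
    exact hq.ne_empty (h.res_eq_empty_of_res_eq_empty hm hs (Nat.find_spec hex) hle)
  obtain ⟨x, hx⟩ := h.nonempty
  have hlt := (hiff (x / s)).1 ⟨_, (mem_iff_mod_mem_res (by omega)).1 hx⟩
  exact ⟨_, (Nat.zero_le _).trans_lt hlt, Nat.find_min' hex hempty, hiff⟩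

theorem exists_isSizeArray : ∃ R p, IsSizeArray m s (s / 2) R p (cnt m s S) := by
  obtain ⟨N, hN, hNle, hiff⟩ := h.exists_res_nonempty_iff hm hs
  have hpos {r k : ℕ} (hlt : r * m + k < N) : 0 < cnt m s S r k :=
    Int.natCast_pos.2 (card_pos.2 ((hiff _).2 hlt))
  have hzero {r k : ℕ} (hle : N ≤ r * m + k) : cnt m s S r k = 0 := by
    rw [cnt, Int.natCast_eq_zero, card_eq_zero, ← not_nonempty_iff_eq_empty, hiff]
    omega
  have hdiv := Nat.div_add_mod' N m
  have hmod := Nat.mod_lt N (show 0 < m by omega)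
  have hrow {r r' : ℕ} (hr : r < r') : r * m + m ≤ r' * m := by
    have := Nat.mul_le_mul_right m (Nat.succ_le_of_lt hr)
    rwa [Nat.succ_mul] at this
  refine ⟨N / m, N % m, {
    p_lt := hmod
    size_pos := by omega
    size_le := by omega
    pos := fun r k hr hk => hpos (by have := hrow hr; omega)
    pos_last := fun k hk => hpos (by omega)
    zero_last := fun k hk _ => hzero (by omega)
    zero := fun r k hr _ => hzero (by have := hrow hr; omega)
    row := h.antitoneOn_cnt hm hs
    col := h.cnt_col hm hs
    cap := fun r k hr hk => ?_
    cap_last := fun r hr => ?_ }⟩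
  · have := cnt_le hm hs h.subset (r := r) (k := k) (by omega)
    rw [top_of_lt hk] at this
    omega
  · have := cnt_le hm hs h.subset (r := r) (k := m - 1) (by omega)
    rw [top_last (by omega)] at this
    omega

theorem defect_res_top_nonneg {r k : ℕ} (hk : k < m) :
    0 ≤ defect (res s S (r * m + k)) (top m s r k) :=
  defect_nonneg fun _ hx => (mem_Ico.1 (res_subset hm hs h.subset hk hx)).2

theorem twiceSize_le : twiceSize S ≤ arrayGain m s (s / 2) (cnt m s S) := by
  rw [twiceSize_eq hm hs h.subset]
  have := sum_nonneg fun r (_ : r ∈ range (s / 2)) => sum_nonneg fun k hk =>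
    h.defect_res_top_nonneg hm hs (r := r) (mem_range.1 hk)
  linarith

theorem lt_of_cnt_add_one_eq {r k H : ℕ} (hk : k + 1 < m)
    (heq : cnt m s S r k = cnt m s S r (k + 1))
    (hlt : ∀ ρ ∈ res s S (r * m + (k + 1)), ρ < H) : ∀ ρ ∈ res s S (r * m + k), ρ < H := by
  intro ρ hρ
  rw [cnt, cnt, Nat.cast_inj] at heq
  have hpos : 0 < (res s S (r * m + (k + 1))).card := heq ▸ card_pos.2 ⟨ρ, hρ⟩
  have hrow := add_one_lt_numRows_mul (by omega) (by omega) hk (card_pos.1 hpos)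
  have hsup := h.cond5 (r * m + k + 1) (by omega) hrow (not_dvd_mul_add_add_one hk)
  rw [a_succ, a_succ, n_succ, n_succ, add_assoc] at hsup
  obtain ⟨σ, hσ⟩ := card_pos.1 hpos
  calc ρ ≤ (res s S (r * m + k)).sup id := le_sup (f := id) hρ
    _ = (res s S (r * m + (k + 1))).sup id := hsup heq hpos
    _ < H := (Finset.sup_lt_iff ((Nat.zero_le σ).trans_lt (hlt σ hσ))).2 hlt

/-- Fifth condition: blocks of equal size in a row share their largest residue, so the smaller
room of the last column is imposed on every block of the same size. -/
theorem lt_of_cnt_eq_last {r k : ℕ} (hk : k < m) (heq : cnt m s S r k = cnt m s S r (m - 1)) :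
    ∀ ρ ∈ res s S (r * m + k), ρ < s - r - 1 := by
  have hkm : k ≤ m - 1 := by omega
  induction hkm using Nat.decreasingInduction with
  | self =>
    intro ρ hρ
    have := (mem_Ico.1 (res_subset hm hs h.subset hk hρ)).2
    rwa [top_last (by omega)] at this
  | of_succ k hkm ih =>
    have hrow := h.cnt_row hm hs r (show k + 1 < m by omega)
    have hlast := h.antitoneOn_cnt hm hs r (show k + 1 < m by omega) (show m - 1 < m by omega)
      (by omega)
    exact h.lt_of_cnt_add_one_eq hm hs (by omega) (by omega) (ih (by omega) (by omega))

end IsGenBetaSet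

end BlockSizes

section Packed

variable {m s : ℕ} {α β : ℕ → ℕ}

/-- The set whose block in row `r` and column `k` consists of all residues from `r + 1 + α k`
to `s - r - β k - 1`; the maximizers are of this form. -/
def packed (m s : ℕ) (α β : ℕ → ℕ) : Finset ℕ :=
  (range (s / 2 * m * s)).filter fun x =>
    x / s / m + 1 + α (x / s % m) ≤ x % s ∧ x % s + x / s / m + β (x / s % m) < s

theorem mem_packed (hm : 0 < m) (hs : 0 < s) {x : ℕ} :
    x ∈ packed m s α β ↔
      x / s / m + 1 + α (x / s % m) ≤ x % s ∧ x % s + x / s / m + β (x / s % m) < s := by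
  rw [packed, mem_filter, mem_range, ← Nat.div_lt_iff_lt_mul hs, ← Nat.div_lt_iff_lt_mul hm]
  omega

theorem res_packed {r k : ℕ} (hk : k < m) :
    res s (packed m s α β) (r * m + k) = Ico (r + 1 + α k) (s - r - β k) := by
  have hm : 0 < m := (Nat.zero_le k).trans_lt hk
  ext ρ
  rw [mem_res, mem_Ico]
  rcases Nat.lt_or_ge ρ s with hρ | hρ
  · have hs : 0 < s := (Nat.zero_le ρ).trans_lt hρ
    have hdiv : ((r * m + k) * s + ρ) / s = r * m + k := by
      rw [mul_comm, Nat.mul_add_div hs, Nat.div_eq_of_lt hρ, add_zero]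
    have hrow : (r * m + k) / m = r := by
      rw [mul_comm, Nat.mul_add_div hm, Nat.div_eq_of_lt hk, add_zero]
    rw [mem_packed hm hs, hdiv, hrow, Nat.mul_add_mod', Nat.mod_eq_of_lt hk, Nat.mul_add_mod',
      Nat.mod_eq_of_lt hρ]
    omega
  · omega

theorem a_packed {r k : ℕ} (hk : k < m) :
    a s (packed m s α β) (r * m + k + 1) = s - r - β k - (r + 1 + α k) := by
  rw [a_succ, res_packed hk, Nat.card_Ico]

theorem cnt_packed {r k : ℕ} (hk : k < m) :
    cnt m s (packed m s α β) r k = ((s - r - β k - (r + 1 + α k) : ℕ) : ℤ) := by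
  rw [cnt, res_packed hk, Nat.card_Ico]

theorem n_packed {r k : ℕ} (hk : k < m) (h : 0 < a s (packed m s α β) (r * m + k + 1)) :
    n s (packed m s α β) (r * m + k + 1) = s - r - β k - 1 := by
  rw [a_packed hk] at h
  rw [n_succ, res_packed hk]
  refine le_antisymm (Finset.sup_le fun x hx => ?_) ?_
  · exact Nat.le_sub_one_of_lt (mem_Ico.1 hx).2
  · exact le_sup (f := id) (mem_Ico.2 (by omega : _ ∧ s - r - β k - 1 < _))

theorem packed_subset (hm : 2 ≤ m) (hs : 2 ≤ s) (hβ : ∀ k, lastInd m k ≤ β k) :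
    (packed m s α β : Set ℕ) ⊆ bigL m s := fun x hx => by
  have hk : x / s % m < m := Nat.mod_lt _ (by omega)
  have hρ : x % s < s := Nat.mod_lt _ (by omega)
  have hx' : (x / s / m * m + x / s % m) * s + x % s = x := by
    rw [Nat.div_add_mod', Nat.div_add_mod']
  have hβk := hβ (x / s % m)
  have hmem := (mem_packed (by omega) (by omega)).1 (mem_coe.1 hx)
  rw [← hx', mul_add_mem_bigL hm hs hk hρ, top]
  omega

theorem exists_row_column {i : ℕ} (hm : 0 < m) (hi : 1 ≤ i) : ∃ r k, k < m ∧ i = r * m + k + 1 :=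
  ⟨(i - 1) / m, (i - 1) % m, Nat.mod_lt _ hm, by rw [Nat.div_add_mod']; omega⟩

theorem exists_row_column_of_not_dvd {i : ℕ} (hm : 0 < m) (hi : 1 ≤ i) (hd : ¬ m ∣ i) :
    ∃ r k, k + 1 < m ∧ i = r * m + k + 1 := by
  obtain ⟨r, k, hk, rfl⟩ := exists_row_column hm hi
  refine ⟨r, k, lt_of_le_of_ne hk fun h => hd ⟨r + 1, ?_⟩, rfl⟩
  rw [add_assoc, h]
  ring

/-- Conditions on the margins `α`, `β` under which `packed m s α β` is a generalized-`β`-set. -/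
structure IsMargin (m s : ℕ) (α β : ℕ → ℕ) : Prop where
  lastInd_le : ∀ k, lastInd m k ≤ β k
  mono : ∀ k, k + 1 < m → α k + β k ≤ α (k + 1) + β (k + 1)
  mono_right : ∀ k, k + 1 < m → β k ≤ β (k + 1)
  tie : ∀ k, k + 1 < m → α k + β k = α (k + 1) + β (k + 1) → β k = β (k + 1)
  last_le : α (m - 1) + β (m - 1) ≤ α 0 + β 0 + 2
  le : ∀ k, k + 1 < m → 2 * (s / 2) + (α k + β k) ≤ s
  le_last : 2 * (s / 2) + (α (m - 1) + β (m - 1)) ≤ s + 2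

namespace IsMargin

variable (h : IsMargin m s α β)
include h

theorem a_pos {r k : ℕ} (hr : r < s / 2) (hk : k < m) (hrk : r + 1 = s / 2 → k + 1 < m) :
    0 < a s (packed m s α β) (r * m + k + 1) := by
  rw [a_packed hk]
  rcases (Nat.succ_le_of_lt hk).lt_or_eq with hlt | heq
  · have := h.le k hlt
    omega
  · obtain rfl : k = m - 1 := by omega
    have := h.le_last
    omega

theorem res_nonempty {r k : ℕ} (hr : r < s / 2) (hk : k + 1 < m) :
    (res s (packed m s α β) (r * m + k)).Nonempty := by
  rw [← card_pos, ← a_succ]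
  exact h.a_pos hr (by omega) fun _ => hk

theorem numRows_packed (hm : 2 ≤ m) (hs : 2 ≤ s) : numRows m s (packed m s α β) = s / 2 := by
  refine le_antisymm (Nat.sInf_le ⟨by omega, fun x hx => ?_⟩) ?_
  · rw [← mul_assoc]
    exact mem_range.1 (mem_filter.1 hx).1
  · have hlt := lt_numRows (by omega) (by omega)
      (h.res_nonempty (r := s / 2 - 1) (k := 0) (by omega) (by omega))
    omega

theorem a_pos_of_lt {i : ℕ} (hm : 0 < m) (hi : 1 ≤ i) (hlt : i < s / 2 * m) :
    0 < a s (packed m s α β) i := by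
  obtain ⟨r, k, hk, rfl⟩ := exists_row_column hm hi
  have hr : r < s / 2 := by
    by_contra! hle
    have := Nat.mul_le_mul_right m hle
    omega
  refine h.a_pos hr hk fun hr' => ?_
  rw [← hr', add_mul, one_mul] at hlt
  omega

theorem a_succ_le {r k : ℕ} (hk : k + 1 < m) :
    a s (packed m s α β) (r * m + k + 1 + 1) ≤ a s (packed m s α β) (r * m + k + 1) := by
  have := h.mono k hk
  rw [a_packed (k := k) (by omega), add_assoc (r * m), a_packed hk]
  omega

omit h in
theorem a_add_two_le {r k : ℕ} (hk : k < m)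
    (hpos : 0 < a s (packed m s α β) (r * m + k + 1 + m)) :
    a s (packed m s α β) (r * m + k + 1 + m) + 2 ≤ a s (packed m s α β) (r * m + k + 1) := by
  rw [show r * m + k + 1 + m = (r + 1) * m + k + 1 by ring, a_packed hk] at *
  rw [a_packed hk]
  omega

theorem n_succ_le {r k : ℕ} (hk : k + 1 < m)
    (hpos : 0 < a s (packed m s α β) (r * m + k + 1 + 1)) :
    n s (packed m s α β) (r * m + k + 1 + 1) ≤ n s (packed m s α β) (r * m + k + 1) := by
  have := h.mono_right k hk
  rw [n_packed (by omega) (hpos.trans_le (h.a_succ_le hk)), add_assoc (r * m),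
    n_packed hk (by rwa [← add_assoc])]
  omega

theorem n_eq_of_a_eq {r k : ℕ} (hk : k + 1 < m)
    (heq : a s (packed m s α β) (r * m + k + 1) = a s (packed m s α β) (r * m + k + 1 + 1))
    (hpos : 0 < a s (packed m s α β) (r * m + k + 1 + 1)) :
    n s (packed m s α β) (r * m + k + 1) = n s (packed m s α β) (r * m + k + 1 + 1) := by
  rw [n_packed (by omega) (heq ▸ hpos), add_assoc (r * m), n_packed hk (by rwa [← add_assoc])]
  rw [a_packed (k := k) (by omega), add_assoc (r * m), a_packed hk] at heq
  rw [add_assoc (r * m), a_packed hk] at hpos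
  have := h.tie k hk (by omega)
  omega

theorem a_first_le_a_last (hm : 0 < m) {r : ℕ} (hr : 1 ≤ r) :
    a s (packed m s α β) (r * m + 1) ≤ a s (packed m s α β) (r * m) := by
  obtain ⟨r, rfl⟩ := Nat.exists_eq_add_of_le' hr
  have := h.last_le
  have hindex : (r + 1) * m = r * m + (m - 1) + 1 := by rw [add_mul]; omega
  calc a s (packed m s α β) ((r + 1) * m + 1) = _ := a_packed (k := 0) hm
    _ ≤ s - r - β (m - 1) - (r + 1 + α (m - 1)) := by omega
    _ = a s (packed m s α β) ((r + 1) * m) := by rw [hindex, a_packed (by omega)]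

theorem isGenBetaSet (hm : 2 ≤ m) (hs : 2 ≤ s) : IsGenBetaSet m s (packed m s α β) := by
  have hm0 : 0 < m := by omega
  have hN := h.numRows_packed hm hs
  obtain ⟨ρ, hρ⟩ := h.res_nonempty (r := 0) (k := 0) (by omega) (by omega)
  refine ⟨⟨_, (mem_res.1 hρ).2⟩, packed_subset hm hs h.lastInd_le, fun i hi hlt hzero => ?_,
    fun i hi _ hd => ?_, fun i hi _ hpos => ?_, fun i hi _ hd hpos => ?_,
    fun i hi _ hd heq hpos => ?_, fun hN2 => h.a_first_le_a_last hm0 (by omega)⟩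
  · rw [ceil_half hs] at hlt
    exact absurd hzero (h.a_pos_of_lt hm0 hi hlt).ne'
  · obtain ⟨r, k, hk, rfl⟩ := exists_row_column_of_not_dvd hm0 hi hd
    exact h.a_succ_le hk
  · obtain ⟨r, k, hk, rfl⟩ := exists_row_column hm0 hi
    exact a_add_two_le hk hpos
  · obtain ⟨r, k, hk, rfl⟩ := exists_row_column_of_not_dvd hm0 hi hd
    exact h.n_succ_le hk hpos
  · obtain ⟨r, k, hk, rfl⟩ := exists_row_column_of_not_dvd hm0 hi hd
    exact h.n_eq_of_a_eq hk heq hpos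

end IsMargin

end Packed

section Maximizers

variable {m s T : ℕ} {α β : ℕ → ℕ}

theorem lastInd_mono {k : ℕ} (h : k + 1 < m) : lastInd m k ≤ lastInd m (k + 1) := by
  rw [lastInd_of_lt h]
  exact Nat.zero_le _

theorem lastInd_le_one (m k : ℕ) : lastInd m k ≤ 1 := by
  rw [lastInd]
  split_ifs <;> omega

theorem isMargin_zero_lastInd (hm : 0 < m) : IsMargin m s (fun _ => 0) (lastInd m) where
  lastInd_le _ := le_rfl
  mono _ hk := by simpa only [zero_add] using lastInd_mono hk
  mono_right _ hk := lastInd_mono hk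
  tie _ _ h := by simpa only [zero_add] using h
  last_le := by rw [lastInd_of_eq (by omega)]; omega
  le _ hk := by rw [lastInd_of_lt hk]; omega
  le_last := by rw [lastInd_of_eq (by omega)]; omega

theorem isMargin_lastInd_lastInd (hm : 0 < m) : IsMargin m s (lastInd m) (lastInd m) where
  lastInd_le _ := le_rfl
  mono _ hk := Nat.add_le_add (lastInd_mono hk) (lastInd_mono hk)
  mono_right _ hk := lastInd_mono hk
  tie _ _ h := by omega
  last_le := by rw [lastInd_of_eq (by omega)]; omega
  le _ hk := by rw [lastInd_of_lt hk]; omega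
  le_last := by rw [lastInd_of_eq (by omega)]; omega

theorem isMargin_zero_one (hs : Odd s) : IsMargin m s (fun _ => 0) (fun _ => 1) where
  lastInd_le := lastInd_le_one m
  mono _ _ := le_rfl
  mono_right _ _ := le_rfl
  tie _ _ _ := rfl
  last_le := by omega
  le _ _ := by obtain ⟨T, rfl⟩ := hs; omega
  le_last := by omega

theorem defect_res_packed {r k : ℕ} (hk : k < m) (h0 : lastInd m k ≤ β k) (hr : r + β k ≤ s) :
    defect (res s (packed m s α β) (r * m + k)) (top m s r k) =
      2 * ((β k - lastInd m k) * cnt m s (packed m s α β) r k) := by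
  rw [cnt, res_packed hk, top,
    show s - r - lastInd m k = s - r - β k + (β k - lastInd m k) by omega, defect_add, defect_Ico,
    Nat.cast_sub h0]
  ring

theorem twiceSize_packed (hm : 2 ≤ m) (hs : 2 ≤ s) (h0 : ∀ k, lastInd m k ≤ β k)
    (h1 : ∀ k, β k ≤ 1) :
    twiceSize (packed m s α β) = arrayGain m s (s / 2) (cnt m s (packed m s α β)) -
      2 * total (s / 2) m fun r k => (β k - lastInd m k) * cnt m s (packed m s α β) r k := by
  rw [twiceSize_eq hm hs (packed_subset hm hs h0), total]
  simp only [mul_sum]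
  congr 1
  refine sum_congr rfl fun r hr => sum_congr rfl fun k hk => ?_
  have hr := mem_range.1 hr
  have := h1 k
  exact defect_res_packed (mem_range.1 hk) (h0 k) (by omega)

theorem three_mul_twiceSize_packed_even (hm : 2 ≤ m) (hT : 1 ≤ T)
    (hα : ∀ k, k + 1 < m → α k = 0) (hlast : α (m - 1) ≤ 1) :
    3 * twiceSize (packed m (2 * T) α (lastInd m)) = evenMax m T := by
  obtain ⟨w, rfl⟩ : ∃ w, m = w + 1 := ⟨m - 1, by omega⟩
  obtain ⟨R, rfl⟩ : ∃ R, T = R + 1 := ⟨T - 1, by omega⟩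
  rw [Nat.add_sub_cancel] at hlast
  rw [twiceSize_packed hm (by omega) (fun _ => le_rfl) (lastInd_le_one _),
    Nat.mul_div_cancel_left _ two_pos]
  simp only [sub_self, zero_mul, total_const, mul_zero, sub_zero]
  rw [three_mul_arrayGain_of_full_columns_of_zero w R (d := fun _ => (α w : ℤ))]
  · rw [moment_const]
    interval_cases α w <;> simp
  · intro r hr k hk
    rw [cnt_packed (by omega), lastInd_of_lt (by omega), hα k (by omega)]
    omega
  · intro r hr
    rw [cnt_packed (by omega), lastInd_of_eq rfl]
    omega
  · rw [cnt_packed (by omega), lastInd_of_eq rfl]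
    omega

theorem three_mul_twiceSize_packed_odd {c : ℕ} (hm : 2 ≤ m) (hT : 1 ≤ T)
    (h0 : ∀ k, lastInd m k ≤ β k) (h1 : ∀ k, β k ≤ 1) (hβ : ∀ k, k + 1 < m → β k = c) :
    3 * twiceSize (packed m (2 * T + 1) (fun _ => 0) β) = oddMax m T := by
  obtain ⟨w, rfl⟩ : ∃ w, m = w + 1 := ⟨m - 1, by omega⟩
  have hc : c ≤ 1 := hβ 0 (by omega) ▸ h1 0
  have hw : β w = 1 := le_antisymm (h1 w) (lastInd_of_eq (m := w + 1) rfl ▸ h0 w)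
  have hcnt {r k : ℕ} (hr : r < T) (hk : k < w + 1) :
      cnt (w + 1) (2 * T + 1) (packed (w + 1) (2 * T + 1) (fun _ => 0) β) r k =
        2 * T - 2 * r - β k := by
    rw [cnt_packed hk]
    have := h1 k
    omega
  have htotal (b : ℕ → ℕ → ℤ) :
      total T (w + 1) (fun r k => ((β k : ℤ) - lastInd (w + 1) k) * b r k) =
        total T w fun r k => c * b r k := by
    rw [total_succ_right, hw, lastInd_of_eq rfl]
    simp only [sub_self, zero_mul, sum_const_zero, add_zero]
    exact total_congr fun r _ k hk => by rw [hβ k (by omega), lastInd_of_lt (by omega)]; simp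
  rw [twiceSize_packed hm (by omega) h0 h1, show (2 * T + 1) / 2 = T by omega, htotal,
    three_mul_arrayGain_of_full_rows (τ := fun _ _ => (c : ℤ))]
  · rw [total_const, rowMoment_const, colMoment_rows]
    interval_cases c <;> simp
  · intros
    interval_cases c <;> rfl
  · intro r hr k hk
    rw [hcnt hr (by omega), hβ k (by omega)]
  · intro r hr
    rw [hcnt hr w.lt_succ_self, hw, Nat.cast_one]

end Maximizers

section UpperBounds

theorem IsSizeArray.lt_evenMax_or_full {m T R p : ℕ} {b : ℕ → ℕ → ℤ}
    (h : IsSizeArray m (2 * T) T R p b) (hm : 2 ≤ m) :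
    3 * arrayGain m (2 * T) T b < evenMax m T ∨ R + 1 = T ∧ p + 1 = m := by
  rcases h.R_le.eq_or_lt with rfl | hRT
  · obtain ⟨U, rfl⟩ : ∃ U, R = U + 1 := by
      refine Nat.exists_eq_succ_of_ne_zero fun hR => ?_
      have := h.size_le
      have := h.size_pos
      simp_all
    have hcap := h.cap_last U U.lt_succ_self
    have hpos := h.pos U (m - 1) U.lt_succ_self (by omega)
    push_cast at hcap
    omega
  · rcases (Nat.succ_le_of_lt hRT).lt_or_eq with hR | hR
    · exact Or.inl (h.lt_evenMax_of_add_two_le hm hR)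
    rcases p.eq_zero_or_pos with rfl | hp
    · exact Or.inl (h.lt_evenMax_of_empty_last_row hm hR)
    rcases (Nat.succ_le_of_lt h.p_lt).lt_or_eq with hpm | hpm
    · exact Or.inl (h.lt_evenMax_of_last_row hR hp hpm)
    · exact Or.inr ⟨hR, hpm⟩

theorem IsSizeArray.lt_oddMax_or_full {m T R p : ℕ} {b : ℕ → ℕ → ℤ}
    (h : IsSizeArray m (2 * T + 1) T R p b) (hm : 2 ≤ m) :
    3 * arrayGain m (2 * T + 1) T b < oddMax m T ∨ R = T ∧ p = 0 := by
  rcases p.eq_zero_or_pos with rfl | hp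
  · rcases h.R_le.eq_or_lt with hR | hR
    · exact Or.inr ⟨hR, rfl⟩
    rcases (Nat.succ_le_of_lt hR).lt_or_eq with hR | hR
    · exact Or.inl (h.lt_oddMax_of_add_two_le hm hR)
    · exact Or.inl (h.lt_oddMax_of_empty_last_row hm hR)
  · rcases (Nat.succ_le_of_lt (h.R_lt hp)).lt_or_eq with hR | rfl
    · exact Or.inl (h.lt_oddMax_of_add_two_le hm hR)
    · obtain ⟨v, rfl⟩ : ∃ v, m = p + v + 1 := ⟨m - p - 1, by have := h.p_lt; omega⟩
      exact Or.inl (h.lt_oddMax_of_last_row hp)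

variable {m s T R p w : ℕ} {S : Finset ℕ} {α β : ℕ → ℕ}

theorem eq_packed (hm : 2 ≤ m) (hs : 2 ≤ s) (hS : (S : Set ℕ) ⊆ bigL m s)
    (h : ∀ r < s / 2, ∀ k < m, res s S (r * m + k) = Ico (r + 1 + α k) (s - r - β k)) :
    S = packed m s α β := by
  refine ext_of_res (s := s) (by omega) fun q => ?_
  have hk : q % m < m := Nat.mod_lt _ (by omega)
  rw [← Nat.div_add_mod' q m, res_packed hk]
  rcases Nat.lt_or_ge (q / m) (s / 2) with hr | hr
  · exact h _ hr _ hk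
  · have hsub := res_subset hm hs hS (r := q / m) hk
    have htop := top_le m s (q / m) (q % m)
    rw [Ico_eq_empty (by omega), subset_empty] at hsub
    rw [hsub, Ico_eq_empty (by omega)]

namespace IsGenBetaSet

theorem res_eq_Ico_of_twiceSize_eq (h : IsGenBetaSet m s S) (hm : 2 ≤ m) (hs : 2 ≤ s)
    (heq : twiceSize S = arrayGain m s (s / 2) (cnt m s S)) {r k : ℕ} (hr : r < s / 2)
    (hk : k < m) :
    res s S (r * m + k) = Ico (top m s r k - (res s S (r * m + k)).card) (top m s r k) := by
  have hnonneg (r k : ℕ) (hk : k ∈ range m) := h.defect_res_top_nonneg hm hs (r := r)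
    (mem_range.1 hk)
  rw [twiceSize_eq hm hs h.subset, sub_eq_self,
    sum_eq_zero_iff_of_nonneg fun r _ => sum_nonneg (hnonneg r)] at heq
  have hrow := heq r (mem_range.2 hr)
  rw [sum_eq_zero_iff_of_nonneg (hnonneg r)] at hrow
  exact eq_Ico_of_defect_eq_zero (fun _ hx => (mem_Ico.1 (res_subset hm hs h.subset hk hx)).2)
    (hrow k (mem_range.2 hk))

section Even

theorem eq_packed_of_lastColumn (h : IsGenBetaSet (p + 1) (2 * (R + 1)) S) (hp : 0 < p)
    (hb : IsSizeArray (p + 1) (2 * (R + 1)) (R + 1) R p (cnt (p + 1) (2 * (R + 1)) S))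
    (heq : twiceSize S = arrayGain (p + 1) (2 * (R + 1)) (R + 1) (cnt (p + 1) (2 * (R + 1)) S))
    (hα : ∀ k < p, α k = 0)
    (hlast : ∀ r < R, cnt (p + 1) (2 * (R + 1)) S r p = 2 * R - 2 * r - α p) :
    S = packed (p + 1) (2 * (R + 1)) α (lastInd (p + 1)) := by
  have hhalf : 2 * (R + 1) / 2 = R + 1 := Nat.mul_div_cancel_left _ two_pos
  refine eq_packed (by omega) (by omega) h.subset fun r hr k hk => ?_
  rw [h.res_eq_Ico_of_twiceSize_eq (by omega) (by omega) (by rwa [hhalf]) hr hk, top]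
  rw [hhalf] at hr
  rcases (Nat.lt_succ_iff.1 hk).lt_or_eq with hkp | rfl
  · have hcard := hb.eq_of_full_column hr hkp
    rw [cnt] at hcard
    rw [lastInd_of_lt (by omega), hα k hkp]
    congr 1
    omega
  rw [lastInd_of_eq rfl]
  rcases (Nat.lt_succ_iff.1 hr).lt_or_eq with hrR | rfl
  · have hcard := hlast r hrR
    rw [cnt] at hcard
    congr 1
    omega
  · have hcard := hb.zero_last k le_rfl k.lt_succ_self
    rw [cnt] at hcard
    rw [Ico_eq_empty (by omega), Ico_eq_empty (by omega)]

theorem le_evenMax (h : IsGenBetaSet m (2 * T) S) (hm : 2 ≤ m) (hT : 1 ≤ T) :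
    3 * twiceSize S ≤ evenMax m T := by
  obtain ⟨R, p, hb⟩ := h.exists_isSizeArray hm (by omega)
  have hle := h.twiceSize_le hm (by omega)
  rw [Nat.mul_div_cancel_left _ two_pos] at hb hle
  rcases hb.lt_evenMax_or_full hm with hlt | ⟨rfl, rfl⟩
  · linarith
  · linarith [hb.le_evenMax]

theorem eq_packed_of_eq_evenMax (h : IsGenBetaSet m (2 * T) S) (hm : 2 ≤ m) (hT : 1 ≤ T)
    (heq : 3 * twiceSize S = evenMax m T) :
    S = packed m (2 * T) (fun _ => 0) (lastInd m) ∨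
      S = packed m (2 * T) (lastInd m) (lastInd m) := by
  obtain ⟨R, p, hb⟩ := h.exists_isSizeArray hm (by omega)
  have hle := h.twiceSize_le hm (by omega)
  rw [Nat.mul_div_cancel_left _ two_pos] at hb hle
  rcases hb.lt_evenMax_or_full hm with hlt | ⟨rfl, rfl⟩
  · linarith
  have hbound := hb.le_evenMax
  refine (hb.lastColumn_eq_of_eq_evenMax (by linarith)).imp (fun hlast => ?_) fun hlast => ?_
  · exact h.eq_packed_of_lastColumn (by omega) hb (by linarith) (fun _ _ => rfl)
      fun r hr => by rw [hlast r hr, Nat.cast_zero, sub_zero]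
  · exact h.eq_packed_of_lastColumn (by omega) hb (by linarith)
      (fun k hk => lastInd_of_lt (by omega))
      fun r hr => by rw [hlast r hr, lastInd_of_eq rfl, Nat.cast_one]

end Even

section Odd

variable (h : IsGenBetaSet (w + 1) (2 * T + 1) S) (hw : 1 ≤ w) (hT : 1 ≤ T)
  (hb : IsSizeArray (w + 1) (2 * T + 1) T T 0 (cnt (w + 1) (2 * T + 1) S))
include h hw hT hb

omit hw hT in
/-- A block of the size of the last one in its row avoids the largest residue of its pyramid. -/
theorem shortfall_mul_cnt_le_defect {r k : ℕ} (hr : r < T) (hk : k < w) :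
    2 * (shortfall T (cnt (w + 1) (2 * T + 1) S) r k * cnt (w + 1) (2 * T + 1) S r k) ≤
      defect (res (2 * T + 1) S (r * (w + 1) + k)) (top (w + 1) (2 * T + 1) r k) := by
  have h0 := hb.shortfall_nonneg r hr k (by omega)
  have h1 := hb.shortfall_le_one r hr k hk
  rcases (by omega : shortfall T (cnt (w + 1) (2 * T + 1) S) r k = 0 ∨
    shortfall T (cnt (w + 1) (2 * T + 1) S) r k = 1) with hτ | hτ <;> rw [hτ]
  · rw [zero_mul, mul_zero]
    exact h.defect_res_top_nonneg (by omega) (by omega) (by omega)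
  · have hlast := hb.lastColumn_eq hr
    rw [shortfall] at hτ
    have hlt := h.lt_of_cnt_eq_last (by omega) (by omega) (r := r) (k := k) (by omega)
      (by rw [Nat.add_sub_cancel]; linarith)
    rw [top_of_lt (by omega), show 2 * T + 1 - r = 2 * T + 1 - r - 1 + 1 by omega, defect_add, cnt]
    have := defect_nonneg hlt
    push_cast
    linarith

theorem twiceSize_le_arrayGain_sub_total :
    twiceSize S ≤ arrayGain (w + 1) (2 * T + 1) T (cnt (w + 1) (2 * T + 1) S) -
      2 * total T w fun r k => shortfall T (cnt (w + 1) (2 * T + 1) S) r k *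
        cnt (w + 1) (2 * T + 1) S r k := by
  rw [twiceSize_eq (by omega) (by omega) h.subset, show (2 * T + 1) / 2 = T by omega, total]
  simp only [mul_sum]
  refine sub_le_sub_left (sum_le_sum fun r hr => ?_) _
  rw [sum_range_succ]
  refine le_add_of_le_of_nonneg (sum_le_sum fun k hk => ?_)
    (h.defect_res_top_nonneg (by omega) (by omega) w.lt_succ_self)
  exact h.shortfall_mul_cnt_le_defect hb (mem_range.1 hr) (mem_range.1 hk)

theorem eq_packed_lastInd_of_shortfall_eq_zero
    (hτ : ∀ r < T, ∀ k < w, shortfall T (cnt (w + 1) (2 * T + 1) S) r k = 0) :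
    S = packed (w + 1) (2 * T + 1) (fun _ => 0) (lastInd (w + 1)) := by
  refine eq_packed (by omega) (by omega) h.subset fun r hr k hk => ?_
  refine eq_of_subset_of_card_le (res_subset (by omega) (by omega) h.subset hk) ?_
  rw [Nat.card_Ico]
  rcases (Nat.lt_succ_iff.1 hk).lt_or_eq with hkw | rfl
  · have hcard := hτ r (by omega) k hkw
    rw [shortfall, cnt] at hcard
    rw [lastInd_of_lt (by omega)]
    omega
  · have hcard := hb.lastColumn_eq (show r < T by omega)
    rw [cnt] at hcard
    rw [lastInd_of_eq rfl]
    omega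

theorem eq_packed_one_of_shortfall_eq_one
    (hτ : ∀ r < T, ∀ k < w, shortfall T (cnt (w + 1) (2 * T + 1) S) r k = 1) :
    S = packed (w + 1) (2 * T + 1) (fun _ => 0) fun _ => 1 := by
  refine eq_packed (by omega) (by omega) h.subset fun r hr k hk => ?_
  have hlast := hb.lastColumn_eq (show r < T by omega)
  have hcard : cnt (w + 1) (2 * T + 1) S r k = 2 * T - 2 * r - 1 := by
    rcases (Nat.lt_succ_iff.1 hk).lt_or_eq with hkw | rfl
    · have := hτ r (by omega) k hkw
      rw [shortfall] at this
      linarith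
    · exact hlast
  refine eq_of_subset_of_card_le (fun ρ hρ => mem_Ico.2 ⟨?_, ?_⟩) ?_
  · exact (mem_Ico.1 (res_subset (by omega) (by omega) h.subset hk hρ)).1
  · exact h.lt_of_cnt_eq_last (by omega) (by omega) hk (hcard.trans hlast.symm) ρ hρ
  · rw [cnt] at hcard
    rw [Nat.card_Ico]
    omega

end Odd

theorem le_oddMax (h : IsGenBetaSet m (2 * T + 1) S) (hm : 2 ≤ m) (hT : 1 ≤ T) :
    3 * twiceSize S ≤ oddMax m T := by
  obtain ⟨R, p, hb⟩ := h.exists_isSizeArray hm (by omega)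
  obtain ⟨w, rfl⟩ : ∃ w, m = w + 1 := ⟨m - 1, by omega⟩
  have hle := h.twiceSize_le hm (by omega)
  rw [show (2 * T + 1) / 2 = T by omega] at hb hle
  rcases hb.lt_oddMax_or_full hm with hlt | ⟨rfl, rfl⟩
  · linarith
  · linarith [hb.le_oddMax, h.twiceSize_le_arrayGain_sub_total (by omega) hT hb]

theorem eq_packed_of_eq_oddMax (h : IsGenBetaSet m (2 * T + 1) S) (hm : 2 ≤ m) (hT : 1 ≤ T)
    (heq : 3 * twiceSize S = oddMax m T) :
    S = packed m (2 * T + 1) (fun _ => 0) (lastInd m) ∨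
      S = packed m (2 * T + 1) (fun _ => 0) (fun _ => 1) := by
  obtain ⟨R, p, hb⟩ := h.exists_isSizeArray hm (by omega)
  obtain ⟨w, rfl⟩ : ∃ w, m = w + 1 := ⟨m - 1, by omega⟩
  have hle := h.twiceSize_le hm (by omega)
  rw [show (2 * T + 1) / 2 = T by omega] at hb hle
  rcases hb.lt_oddMax_or_full hm with hlt | ⟨rfl, rfl⟩
  · linarith
  have hw : 1 ≤ w := by omega
  have hdefect := h.twiceSize_le_arrayGain_sub_total hw hT hb
  exact (hb.shortfall_eq_of_eq_oddMax (by linarith [hb.le_oddMax])).imp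
    (h.eq_packed_lastInd_of_shortfall_eq_zero hw hT hb)
    (h.eq_packed_one_of_shortfall_eq_one hw hT hb)

end IsGenBetaSet

end UpperBounds

section Cases

variable {m s T : ℕ} {α : ℕ → ℕ}

theorem sizeCount_le_iff {S S' : Finset ℕ} :
    sizeCount S ≤ sizeCount S' ↔ twiceSize S ≤ twiceSize S' := by
  rw [← Int.cast_le (R := ℚ), ← two_mul_sizeCount, ← two_mul_sizeCount]
  exact (mul_le_mul_iff_right₀ two_pos).symm

theorem isMaximizer_iff_of_bound {A B : Finset ℕ} {c : ℤ} (hA : IsGenBetaSet m s A)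
    (hB : IsGenBetaSet m s B) (hAc : 3 * twiceSize A = c) (hBc : 3 * twiceSize B = c)
    (hle : ∀ S, IsGenBetaSet m s S → 3 * twiceSize S ≤ c)
    (heq : ∀ S, IsGenBetaSet m s S → 3 * twiceSize S = c → S = A ∨ S = B) (S : Finset ℕ) :
    IsMaximizer m s S ↔ S = A ∨ S = B := by
  constructor
  · rintro ⟨hS, hmax⟩
    have hAS := sizeCount_le_iff.1 (hmax A hA)
    exact heq S hS (by linarith [hle S hS])
  · rintro (rfl | rfl)
    · exact ⟨hA, fun S' hS' => sizeCount_le_iff.2 (by linarith [hle S' hS'])⟩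
    · exact ⟨hB, fun S' hS' => sizeCount_le_iff.2 (by linarith [hle S' hS'])⟩

theorem isMaximizer_even_iff (hm : 2 ≤ m) (hT : 1 ≤ T) (S : Finset ℕ) :
    IsMaximizer m (2 * T) S ↔ S = packed m (2 * T) (fun _ => 0) (lastInd m) ∨
      S = packed m (2 * T) (lastInd m) (lastInd m) :=
  isMaximizer_iff_of_bound ((isMargin_zero_lastInd (by omega)).isGenBetaSet hm (by omega))
    ((isMargin_lastInd_lastInd (by omega)).isGenBetaSet hm (by omega))
    (three_mul_twiceSize_packed_even hm hT (fun _ _ => rfl) zero_le_one)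
    (three_mul_twiceSize_packed_even hm hT (fun _ => lastInd_of_lt) (lastInd_le_one _ _))
    (fun _ h => h.le_evenMax hm hT) (fun _ h => h.eq_packed_of_eq_evenMax hm hT) S

theorem isMaximizer_odd_iff (hm : 2 ≤ m) (hT : 1 ≤ T) (S : Finset ℕ) :
    IsMaximizer m (2 * T + 1) S ↔ S = packed m (2 * T + 1) (fun _ => 0) (lastInd m) ∨
      S = packed m (2 * T + 1) (fun _ => 0) (fun _ => 1) :=
  isMaximizer_iff_of_bound ((isMargin_zero_lastInd (by omega)).isGenBetaSet hm (by omega))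
    ((isMargin_zero_one ⟨T, rfl⟩).isGenBetaSet hm (by omega))
    (three_mul_twiceSize_packed_odd hm hT (fun _ => le_rfl) (lastInd_le_one m)
      fun _ => lastInd_of_lt)
    (three_mul_twiceSize_packed_odd hm hT (lastInd_le_one m) (fun _ => le_rfl) fun _ _ => rfl)
    (fun _ h => h.le_oddMax hm hT) (fun _ h => h.eq_packed_of_eq_oddMax hm hT) S

theorem mul_eq_sub_one_mul_add (hm : 0 < m) (hT : 1 ≤ T) :
    T * m = (T - 1) * m + (m - 1) + 1 := by
  obtain ⟨U, rfl⟩ := Nat.exists_eq_add_of_le' hT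
  rw [Nat.add_sub_cancel, add_mul]
  omega

theorem oddCase2_packed (hm : 2 ≤ m) (hT : 1 ≤ T) :
    OddCase2 m (2 * T + 1) (packed m (2 * T + 1) (fun _ => 0) (lastInd m)) := by
  have hN := (isMargin_zero_lastInd (m := m) (s := 2 * T + 1) (by omega)).numRows_packed hm
    (by omega)
  rw [show (2 * T + 1) / 2 = T by omega] at hN
  rw [OddCase2, hN, mul_eq_sub_one_mul_add (by omega) hT]
  refine ⟨by omega, fun i hlow hhigh => ?_, ?_⟩
  · obtain ⟨k, rfl⟩ := Nat.exists_eq_add_of_le hlow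
    rw [add_right_comm, a_packed (by omega), lastInd_of_lt (by omega)]
    omega
  · rw [a_packed (by omega), lastInd_of_eq (by omega)]
    omega

theorem oddCase1_packed (hm : 2 ≤ m) (hT : 1 ≤ T) :
    OddCase1 m (2 * T + 1) (packed m (2 * T + 1) (fun _ => 0) (fun _ => 1)) := by
  have hN := (isMargin_zero_one (m := m) (s := 2 * T + 1) ⟨T, rfl⟩).numRows_packed hm (by omega)
  rw [show (2 * T + 1) / 2 = T by omega] at hN
  rw [OddCase1, hN, mul_eq_sub_one_mul_add (by omega) hT]
  refine ⟨by omega, fun i hlow hhigh => ?_⟩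
  obtain ⟨k, rfl⟩ := Nat.exists_eq_add_of_le hlow
  rw [add_right_comm, a_packed (by omega)]
  omega

theorem OddCase1.not_oddCase2 {S : Finset ℕ} (hm : 2 ≤ m) (hs : 0 < s) (h : OddCase1 m s S) :
    ¬ OddCase2 m s S := fun h' => by
  have hrows := (numRows_spec (m := m) (by omega) hs S).1
  have hindex := mul_eq_sub_one_mul_add (m := m) (by omega) hrows
  have hone := h.2 _ le_rfl (by omega)
  have htwo := h'.2.1 _ le_rfl (by omega)
  omega

theorem IsMargin.evenLastRow_packed (h : IsMargin m (2 * T) α (lastInd m)) (hm : 2 ≤ m)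
    (hT : 1 ≤ T) (hα : ∀ k, k + 1 < m → α k = 0) :
    EvenLastRow m (2 * T) (packed m (2 * T) α (lastInd m)) := by
  have hN := h.numRows_packed hm (by omega)
  rw [Nat.mul_div_cancel_left _ two_pos] at hN
  rw [EvenLastRow, hN, mul_eq_sub_one_mul_add (by omega) hT]
  refine ⟨by omega, fun i hlow hhigh => ?_, ?_⟩
  · obtain ⟨k, rfl⟩ := Nat.exists_eq_add_of_le hlow
    rw [add_right_comm, a_packed (by omega), lastInd_of_lt (by omega), hα k (by omega)]
    omega
  · rw [a_packed (by omega), lastInd_of_eq (by omega)]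
    omega

theorem a_packed_last_column (hm : 0 < m) (hT : 2 ≤ T) :
    a (2 * T) (packed m (2 * T) α (lastInd m)) ((T - 1) * m) = 2 - α (m - 1) := by
  rw [mul_eq_sub_one_mul_add hm (by omega), a_packed (by omega), lastInd_of_eq (by omega)]
  omega

theorem evenCase2_packed (hm : 2 ≤ m) (hT : 2 ≤ T) :
    EvenCase2 m (2 * T) (packed m (2 * T) (fun _ => 0) (lastInd m)) := by
  have h := (isMargin_zero_lastInd (m := m) (s := 2 * T) (by omega)).evenLastRow_packed hm
    (by omega) fun _ _ => rfl
  refine ⟨h, ?_⟩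
  rw [h.1, Nat.mul_div_cancel_left _ two_pos, a_packed_last_column (by omega) hT]

theorem evenCase1_packed (hm : 2 ≤ m) (hT : 2 ≤ T) :
    EvenCase1 m (2 * T) (packed m (2 * T) (lastInd m) (lastInd m)) := by
  have h := (isMargin_lastInd_lastInd (m := m) (s := 2 * T) (by omega)).evenLastRow_packed hm
    (by omega) fun _ => lastInd_of_lt
  refine ⟨h, ?_⟩
  rw [h.1, Nat.mul_div_cancel_left _ two_pos, a_packed_last_column (by omega) hT,
    lastInd_of_eq (by omega)]

theorem packed_two_eq (hm : 2 ≤ m) :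
    packed m 2 (lastInd m) (lastInd m) = packed m 2 (fun _ => 0) (lastInd m) := by
  refine eq_packed hm le_rfl (packed_subset hm le_rfl fun _ => le_rfl) fun r _ k hk => ?_
  rw [res_packed hk]
  rcases Nat.lt_or_ge (k + 1) m with hkm | hkm
  · rw [lastInd_of_lt hkm]
  · rw [lastInd_of_eq (by omega), Ico_eq_empty (by omega), Ico_eq_empty (by omega)]

theorem isMaximizer_two_iff (hm : 2 ≤ m) (S : Finset ℕ) :
    IsMaximizer m 2 S ↔ S = packed m 2 (fun _ => 0) (lastInd m) := by
  have hiff := isMaximizer_even_iff (T := 1) hm le_rfl S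
  rwa [mul_one, packed_two_eq hm, or_self] at hiff

theorem or_and_existsUnique_of_iff {X : Type*} {M P Q : X → Prop} {A B : X}
    (hM : ∀ S, M S ↔ S = A ∨ S = B) (hP : P B) (hQ : Q A) (hPQ : ∀ S, P S → ¬ Q S) :
    (∀ S, M S → P S ∨ Q S) ∧ (∃! S, M S ∧ P S) ∧ ∃! S, M S ∧ Q S := by
  refine ⟨fun S hS => ?_, ⟨B, ⟨(hM B).2 (Or.inr rfl), hP⟩, fun S hS => ?_⟩,
    ⟨A, ⟨(hM A).2 (Or.inl rfl), hQ⟩, fun S hS => ?_⟩⟩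
  · rcases (hM S).1 hS with rfl | rfl
    · exact Or.inr hQ
    · exact Or.inl hP
  · exact ((hM S).1 hS.1).resolve_left fun h => hPQ S hS.2 (h ▸ hQ)
  · exact ((hM S).1 hS.1).resolve_right fun h => hPQ S (h ▸ hP) hS.2

end Cases

end GenBeta

theorem mainTheorem2 (m s : ℕ) (hm : 2 ≤ m) (hs : 2 ≤ s) :
    (Odd s →
      (∀ S, GenBeta.IsMaximizer m s S → GenBeta.OddCase1 m s S ∨ GenBeta.OddCase2 m s S) ∧
      (∃! S, GenBeta.IsMaximizer m s S ∧ GenBeta.OddCase1 m s S) ∧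
      (∃! S, GenBeta.IsMaximizer m s S ∧ GenBeta.OddCase2 m s S)) ∧
    (Even s → 4 ≤ s →
      (∀ S, GenBeta.IsMaximizer m s S → GenBeta.EvenCase1 m s S ∨ GenBeta.EvenCase2 m s S) ∧
      (∃! S, GenBeta.IsMaximizer m s S ∧ GenBeta.EvenCase1 m s S) ∧
      (∃! S, GenBeta.IsMaximizer m s S ∧ GenBeta.EvenCase2 m s S)) ∧
    (s = 2 →
      (∀ S, GenBeta.IsMaximizer m s S → GenBeta.EvenLastRow m s S) ∧
      (∃! S, GenBeta.IsMaximizer m s S)) := by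
  refine ⟨?_, ?_, ?_⟩
  · rintro ⟨T, rfl⟩
    exact GenBeta.or_and_existsUnique_of_iff (GenBeta.isMaximizer_odd_iff hm (by omega))
      (GenBeta.oddCase1_packed hm (by omega)) (GenBeta.oddCase2_packed hm (by omega))
      fun S h => h.not_oddCase2 hm (by omega)
  · intro heven hfour
    obtain ⟨T, rfl⟩ := even_iff_two_dvd.1 heven
    exact GenBeta.or_and_existsUnique_of_iff (GenBeta.isMaximizer_even_iff hm (by omega))
      (GenBeta.evenCase1_packed hm (by omega)) (GenBeta.evenCase2_packed hm (by omega))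
      fun S h h' => absurd (h.2.symm.trans h'.2) (by decide)
  · rintro rfl
    refine ⟨fun S hS => ?_, _, (GenBeta.isMaximizer_two_iff hm _).2 rfl,
      fun S => (GenBeta.isMaximizer_two_iff hm S).1⟩
    rw [(GenBeta.isMaximizer_two_iff hm S).1 hS]
    exact (GenBeta.isMargin_zero_lastInd (m := m) (s := 2 * 1) (by omega)).evenLastRow_packed hm
      le_rfl fun _ _ => rfl
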